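/- Let $\mathbb H$ be the quaternions, $n\ge 0$, and let $\Omega\subset\mathbb H^n$ be open. Write $q_i=\sum_{a=0}^3 x_i^a e_a$ with $e_0=1,e_1=i,e_2=j,e_3=k$, and put $$\frac{\partial f}{\partial\bar q_i}=\sum_a e_a\frac{\partial f}{\partial x_i^a},\qquad \frac{\partial f}{\partial q_i}=\overline{\frac{\partial \bar f}{\partial\bar q_i}}=\sum_a\frac{\partial f}{\partial x_i^a}\bar e_a .$$ For a real valued $u$ let $\partial^2u$ denote the $n\times n$ matrix with $(i,j)$ entry $$\frac{\partial}{\partial\bar q_i}\frac{\partial u}{\partial q_j}=\frac{\partial}{\partial q_j}\frac{\partial u}{\partial \bar q_i}=\sum_{a,b}e_a\bar e_b\,\frac{\partial^2u}{\partial x_i^a\,\partial x_j^b}.$$ A quaternionic matrix $A$ is hyperhermitian if $A^*=A$, and such an $A$ is non-negative if $\xi^*A\xi\ge0$ for every column $\xi\in\mathbb H^n$. Let $\mathcal H_n$ be the real vector space of hyperhermitian $n\times n$ matrices. An $\mathcal H_n$-valued measure on $\Omega$ is a countably additive $\mathcal H_n$-valued set function on the Borel sets that are contained in compact subsets of $\Omega$;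 it is non-negative if all its values are. Let $u:\Omega\to\mathbb R$ be quaternionic plurisubharmonic, i.e. (finite valued,) upper semi-continuous and such that its restriction to every right quaternionic line $\{z+vq: q\in\mathbb H\}$, $v\neq0$, is subharmonic. For $\chi\in C_c^\infty(\mathbb H^n)$ with $\chi\ge0$ and $\int\chi=1$, and $\varepsilon>0$, put $\chi_\varepsilon(z)=\varepsilon^{-4n}\chi(z/\varepsilon)$ and $u_\varepsilon=u\star\chi_\varepsilon$ on $\Omega_\varepsilon=\{z: z-\operatorname{supp}\chi_\varepsilon\subset\Omega\}$. Then $u\in L^1_{loc}(\Omega)$, each $u_\varepsilon$ is $C^\infty$ on $\Omega_\varepsilon$, and there is an $\mathcal H_n$-valued measure $\mu$ on $\Omega$ such that: 1. for every such $\chi$ the measures $\partial^2u_\varepsilon\,d\mathrm{vol}$ converge weakly to $\mu$ as $\varepsilon\to0^+$, that is, $\int\varphi\,\partial^2u_\varepsilon\,d\mathrm{vol}\to\int\varphi\,d\mu$ for every continuous $\varphi:\mathbb H^n\to\mathbb R$ with compact support contained in $\Omega$; and $\mu$ is the only $\mathcal H_n$-valued measure on $\Omega$ that is such a weak limit for some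 $\chi$; 2. $\mu$ is non-negative; 3. if $u\in C^2(\Omega)$, then $\mu=\partial^2u\,d\mathrm{vol}$, that is, $\mu(A)=\int_A\partial^2u\,d\mathrm{vol}$ for every Borel set $A$ contained in a compact subset of $\Omega$. The measure $\mu$ is the matrix-valued measure of second quaternionic derivatives of $u$. -/

import Mathlib

open MeasureTheory Filter Topology Set
open scoped Quaternion ContDiff

noncomputable section

/-- The Borel σ-algebra on the quaternions. The measure `volume` on `ℍ` is then the one of the
Euclidean space `ℍ = ℝ⁴`, i.e. Lebesgue measure. -/
instance quaternionMeasurableSpace : MeasurableSpace ℍ := borel ℍ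

instance quaternionBorelSpace : BorelSpace ℍ := ⟨rfl⟩

/-- The space `ℍⁿ`, with its product topology and Lebesgue measure. -/
abbrev QSpace (n : ℕ) : Type := Fin n → ℍ

/-- The quaternionic units `e₀ = 1, e₁ = i, e₂ = j, e₃ = k`. -/
def quatUnit : Fin 4 → ℍ := ![⟨1, 0, 0, 0⟩, ⟨0, 1, 0, 0⟩, ⟨0, 0, 1, 0⟩, ⟨0, 0, 0, 1⟩]

/-! ### Plurisubharmonic functions -/

/-- A real valued (finite) function `g` is subharmonic on the open set `U ⊆ ℍ = ℝ⁴`: it is upper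
semi-continuous and satisfies the sub-mean value inequality on all closed balls contained in `U`.
The mean value of an upper semi-continuous function over such a ball is a priori a number in
`[-∞, ∞)`; the inequality with the real number `g a` on the left says in particular that it is
not `-∞`, i.e. that `g` is integrable over the ball. -/
structure SubharmonicOnQuat (U : Set ℍ) (g : ℍ → ℝ) : Prop where
  usc : UpperSemicontinuousOn g U
  integrableOn : ∀ (a : ℍ) (r : ℝ), 0 < r → Metric.closedBall a r ⊆ U →
    IntegrableOn g (Metric.closedBall a r) volume
  le_average : ∀ (a : ℍ) (r : ℝ), 0 < r → Metric.closedBall a r ⊆ U →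
    g a ≤ ⨍ q in Metric.closedBall a r, g q ∂volume

/-- A (finite) function `u` is quaternionic plurisubharmonic on `Ω`: it is upper semi-continuous
on `Ω` and its restriction to every right quaternionic line `{z + v q | q ∈ ℍ}`, `v ≠ 0`, is
subharmonic. Only the values of `u` on `Ω` matter. -/
structure QuatPsh {n : ℕ} (Ω : Set (QSpace n)) (u : QSpace n → ℝ) : Prop where
  usc : UpperSemicontinuousOn u Ω
  subharmonic : ∀ z v : QSpace n, v ≠ 0 →
    SubharmonicOnQuat {q : ℍ | (fun i => z i + v i * q) ∈ Ω} (fun q => u (fun i => z i + v i * q))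

/-! ### The quaternionic Hessian -/

/-- The partial derivative of `f` at `z` with respect to the real coordinate `x_i^a`, where
`q_i = ∑ₐ x_i^a eₐ`. -/
def quatPartial {n : ℕ} (i : Fin n) (a : Fin 4) (f : QSpace n → ℍ) (z : QSpace n) : ℍ :=
  fderiv ℝ f z (Pi.single i (quatUnit a))

/-- `∂f/∂q̄_i = ∂f/∂t + i ∂f/∂x + j ∂f/∂y + k ∂f/∂z`, where `q_i = t + x i + y j + z k`. -/
def quatDbar {n : ℕ} (i : Fin n) (f : QSpace n → ℍ) (z : QSpace n) : ℍ :=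
  ∑ a, quatUnit a * quatPartial i a f z

/-- `∂f/∂q_i`, the quaternionic conjugate of `∂f̄/∂q̄_i`, that is
`∂f/∂q_i = ∂f/∂t - ∂f/∂x i - ∂f/∂y j - ∂f/∂z k`. -/
def quatD {n : ℕ} (i : Fin n) (f : QSpace n → ℍ) (z : QSpace n) : ℍ :=
  star (quatDbar i (fun w => star (f w)) z)

/-- The quaternionic Hessian of a real valued function `u`. Its `(i, j)` entry is
`∂/∂q̄_i (∂u/∂q_j) = ∂/∂q_j (∂u/∂q̄_i) = ∑_{a,b} eₐ ēᵦ ∂²u/∂x_i^a ∂x_j^b`. With this order of the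
indices the Hessian of a `C²` function is non-negative definite exactly when the function is
plurisubharmonic with respect to *right* quaternionic lines. -/
def quatHessian {n : ℕ} (u : QSpace n → ℝ) (z : QSpace n) : Matrix (Fin n) (Fin n) ℍ :=
  Matrix.of fun i j => quatDbar i (quatD j (fun w => (u w : ℍ))) z

/-- A hyperhermitian matrix `A` is non-negative definite if `ξ* A ξ ≥ 0` for all columns `ξ`
(the quaternion `ξ* A ξ` is real for hyperhermitian `A`). -/
def QuatNonneg {n : ℕ} (A : Matrix (Fin n) (Fin n) ℍ) : Prop :=
  A.IsHermitian ∧ ∀ ξ : Fin n → ℍ, 0 ≤ (∑ i, ∑ j, star (ξ i) * A i j * ξ j).re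

/-! ### Measures with values in hyperhermitian matrices -/

/-- Borel sets contained in some compact subset of `Ω`. -/
def RelCompactBorel {n : ℕ} (Ω A : Set (QSpace n)) : Prop :=
  MeasurableSet A ∧ ∃ K, IsCompact K ∧ K ⊆ Ω ∧ A ⊆ K

/-- A (Radon) measure on `Ω` with values in the real vector space of hyperhermitian
`n × n` matrices: a set function on the Borel sets that are relatively compact in `Ω`, countably
additive. Such a measure need not extend to all Borel subsets of `Ω`; the value at the other sets
is set to `0` by convention. -/
@[ext]
structure HyperhermitianMeasure {n : ℕ} (Ω : Set (QSpace n)) where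
  val : Set (QSpace n) → Matrix (Fin n) (Fin n) ℍ
  isHermitian : ∀ A, (val A).IsHermitian
  eq_zero : ∀ A, ¬ RelCompactBorel Ω A → val A = 0
  hasSum : ∀ A : ℕ → Set (QSpace n), (∀ k, MeasurableSet (A k)) →
    Pairwise (fun k l => Disjoint (A k) (A l)) → RelCompactBorel Ω (⋃ k, A k) →
    HasSum (fun k => val (A k)) (val (⋃ k, A k))

namespace HyperhermitianMeasure

variable {n : ℕ} {Ω : Set (QSpace n)}

/-- The measure is non-negative: its values are non-negative definite matrices. -/
def Nonneg (μ : HyperhermitianMeasure Ω) : Prop := ∀ A, QuatNonneg (μ.val A)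

theorem val_empty (μ : HyperhermitianMeasure Ω) : μ.val ∅ = 0 := by
  have h := μ.hasSum (fun _ => ∅) (fun _ => MeasurableSet.empty) (fun _ _ _ => disjoint_bot_left)
    ⟨by simp, ∅, isCompact_empty, empty_subset _, by simp⟩
  exact tendsto_nhds_unique tendsto_const_nhds h.summable.tendsto_atTop_zero

open scoped Classical in
/-- The finite vector measure `A ↦ μ (A ∩ K)`, for a compact `K ⊆ Ω`. -/
def toVectorMeasure (μ : HyperhermitianMeasure Ω) (K : Set (QSpace n)) (hK : IsCompact K)
    (hKΩ : K ⊆ Ω) : VectorMeasure (QSpace n) (Matrix (Fin n) (Fin n) ℍ) where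
  measureOf' A := if MeasurableSet A then μ.val (A ∩ K) else 0
  empty' := by simp [val_empty]
  not_measurable' A hA := by simp [hA]
  m_iUnion' A hA hd := by
    have hKm : MeasurableSet K := hK.isClosed.measurableSet
    rw [if_pos (MeasurableSet.iUnion hA)]
    simp only [if_pos (hA _)]
    rw [iUnion_inter]
    exact μ.hasSum (fun k => A k ∩ K) (fun k => (hA k).inter hKm)
      (fun k l hkl => (hd hkl).mono inter_subset_left inter_subset_left)
      ⟨MeasurableSet.iUnion fun k => (hA k).inter hKm, K, hK, hKΩ,
        iUnion_subset fun k => inter_subset_right⟩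

/-- The coordinate along `eₐ` of the `(i, j)` entry of a quaternionic matrix. -/
def entryCoord (i j : Fin n) (a : Fin 4) : Matrix (Fin n) (Fin n) ℍ →+ ℝ :=
  (innerSL ℝ (quatUnit a)).toLinearMap.toAddMonoidHom.comp
    (Matrix.entryAddMonoidHom ℍ i j)

theorem continuous_entryCoord (i j : Fin n) (a : Fin 4) :
    Continuous (entryCoord (n := n) i j a) :=
  (innerSL ℝ (quatUnit a)).continuous.comp (continuous_apply_apply i j)

/-- The finite signed measure on the compact set `K ⊆ Ω` obtained from the coordinate along `eₐ`
of the `(i, j)` entry of `μ`. -/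
def entryMeasure (μ : HyperhermitianMeasure Ω) (K : Set (QSpace n)) (hK : IsCompact K)
    (hKΩ : K ⊆ Ω) (i j : Fin n) (a : Fin 4) : SignedMeasure (QSpace n) :=
  (μ.toVectorMeasure K hK hKΩ).mapRange (entryCoord i j a) (continuous_entryCoord i j a)

/-- The integral `∫ φ dμ` of a scalar function `φ` whose support is compact and contained in `Ω`.
It is computed in the real coordinates of the matrix entries. -/
def integral (μ : HyperhermitianMeasure Ω) (φ : QSpace n → ℝ) (hφ : HasCompactSupport φ)
    (hφΩ : tsupport φ ⊆ Ω) : Matrix (Fin n) (Fin n) ℍ :=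
  Matrix.of fun i j => ∑ a,
    (∫ᵛ z, φ z ∂•(μ.entryMeasure (tsupport φ) hφ hφΩ i j a)) • quatUnit a

end HyperhermitianMeasure

/-! ### Mollification -/

/-- A smoothing kernel: a smooth non-negative function with compact support and integral `1`. -/
structure SmoothingKernel {n : ℕ} (χ : QSpace n → ℝ) : Prop where
  smooth : ContDiff ℝ ∞ χ
  nonneg : ∀ z, 0 ≤ χ z
  compactSupport : HasCompactSupport χ
  integral_eq_one : ∫ z, χ z = 1

/-- The rescaled kernel `χ_ε(z) = ε^{-4n} χ(z/ε)`. -/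
def scaledKernel {n : ℕ} (χ : QSpace n → ℝ) (ε : ℝ) (z : QSpace n) : ℝ :=
  (ε ^ (4 * n))⁻¹ * χ (ε⁻¹ • z)

/-- The mollification `u_ε(z) = (u ⋆ χ_ε)(z) = ∫ χ_ε(w) u(z - w) dw`. -/
def mollify {n : ℕ} (χ : QSpace n → ℝ) (u : QSpace n → ℝ) (ε : ℝ) : QSpace n → ℝ :=
  convolution (scaledKernel χ ε) u (ContinuousLinearMap.lsmul ℝ ℝ) volume

/-- The set `Ω_ε` of the points `z` with `z - supp χ_ε ⊆ Ω`, on which `u_ε` is determined by the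
values of `u` on `Ω`. -/
def mollifyDomain {n : ℕ} (χ : QSpace n → ℝ) (Ω : Set (QSpace n)) (ε : ℝ) : Set (QSpace n) :=
  {z | ∀ w ∈ tsupport χ, z - ε • w ∈ Ω}

/-- The measures `(∂²u_ε/∂q̄_i∂q_j) dvol` converge weakly on `Ω` to `μ` as `ε → 0+`. The support
of a test function `φ` is contained in the domain of `u_ε` for all sufficiently small `ε`. -/
def HessianWeakLimit {n : ℕ} {Ω : Set (QSpace n)} (χ : QSpace n → ℝ) (u : QSpace n → ℝ)
    (μ : HyperhermitianMeasure Ω) : Prop :=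
  ∀ (φ : QSpace n → ℝ), Continuous φ → ∀ (hφ : HasCompactSupport φ) (hφΩ : tsupport φ ⊆ Ω),
    ∀ i j : Fin n,
      Tendsto (fun ε : ℝ => ∫ z, φ z • quatHessian (mollify χ u ε) z i j) (𝓝[>] 0)
        (𝓝 (μ.integral φ hφ hφΩ i j))

end

/-!
The measure is obtained from the Laplacians of `u` along right quaternionic lines. For `ξ : ℍⁿ` let
`Δ_ξ f (z)` be the Laplacian at `q = 0` of `q ↦ f (z + ξ q)` (`lineLaplacian`). For a `C²` function
`f` the quaternionic Hessian is hyperhermitian, and its quadratic form is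
`Re (ξ* (∂²f) ξ) = Δ_ξ f` (`quatForm_quatHessian`). A hyperhermitian matrix is recovered linearly
from its quadratic form (`polarize`), so everything can be done for the scalar operators `Δ_ξ`.

* A plurisubharmonic function is bounded above on a polydisc, and iterating the sub-mean value
  inequality over the coordinates bounds `∫ (M - u)` by the value of `M - u` at the centre; hence
  `u` is locally integrable (`QuatPsh.integrableOn_closedBall`).
* The convolution of `u` with a non-negative smooth kernel satisfies the sub-mean value inequality
  on small balls in quaternionic lines, and Taylor's formula turns this into `Δ_ξ (u ⋆ χ) ≥ 0`
  (`QuatPsh.lineLaplacian_convolution_nonneg`). Since `∫ u Δ_ξ φ` is the value at `0` of `Δ_ξ`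
  applied to the convolution of `u` with the reflection of `φ`, the distribution `φ ↦ ∫ u Δ_ξ φ` is
  positive. The M. Riesz extension theorem and the Riesz-Markov-Kakutani theorem make it a measure
  `m ξ` (`exists_measure_eq_of_nonneg`, `QuatPsh.exists_isLaplacianFamily`).
* The functions `Δ_ξ u_ε` are the mollifications of `m ξ`, so they converge weakly to `m ξ` by
  Fubini's theorem (`IsLaplacianFamily.tendsto_integral_mollify`).
* The measure `μ` (`IsLaplacianFamily.hessianMeasure`) is the polarization of `ξ ↦ m ξ`. That
  `ξ ↦ m ξ A` is the quadratic form of a hyperhermitian matrix holds with test functions in place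
  of the set `A`, by the pointwise identities for the smooth functions `u ⋆ χ`. It passes to compact
  sets, whose indicators are limits of test functions, and from there to relatively compact Borel
  sets by a π-λ argument (`RelCompactBorel.eq_zero_of_forall_isCompact`). Uniqueness and the formula
  for a `C²` function `u` use the same two steps; in the latter the starting point is
  `∫ u Δ_ξ φ = ∫ φ Δ_ξ u`, i.e. the symmetry of the convolution.
-/

noncomputable section

/-! ### Test functions -/

section TestFunctions

variable {E : Type*} [NormedAddCommGroup E] [NormedSpace ℝ E]

/-- A test function on `Ω`: a smooth function on the whole space whose support is compact and
contained in `Ω`. -/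
structure IsTestFunction (Ω : Set E) (φ : E → ℝ) : Prop where
  contDiff : ContDiff ℝ ∞ φ
  hasCompactSupport : HasCompactSupport φ
  tsupport_subset : tsupport φ ⊆ Ω

theorem IsTestFunction.add {Ω : Set E} {φ ψ : E → ℝ} (hφ : IsTestFunction Ω φ)
    (hψ : IsTestFunction Ω ψ) : IsTestFunction Ω (φ + ψ) :=
  ⟨hφ.contDiff.add hψ.contDiff, hφ.hasCompactSupport.add hψ.hasCompactSupport,
    (tsupport_add φ ψ).trans (union_subset hφ.tsupport_subset hψ.tsupport_subset)⟩

theorem IsTestFunction.const_smul {Ω : Set E} {φ : E → ℝ} (hφ : IsTestFunction Ω φ) (c : ℝ) :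
    IsTestFunction Ω (c • φ) :=
  ⟨hφ.contDiff.const_smul c, hφ.hasCompactSupport.smul_left (f := fun _ => c),
    (tsupport_smul_subset_right (fun _ => c) φ).trans hφ.tsupport_subset⟩

variable [FiniteDimensional ℝ E]

theorem exists_isTestFunction_one_nhdsSet {Ω K : Set E} (hΩ : IsOpen Ω) (hK : IsCompact K)
    (hKΩ : K ⊆ Ω) :
    ∃ ψ : E → ℝ, IsTestFunction Ω ψ ∧ (∀ x, ψ x ∈ Icc (0 : ℝ) 1) ∧ ∀ᶠ x in 𝓝ˢ K, ψ x = 1 := by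
  obtain ⟨L, hL, hKL, hLΩ⟩ := exists_compact_between hK hΩ hKΩ
  obtain ⟨f, h1, h0, h01⟩ := exists_contMDiffMap_one_nhds_of_subset_interior (n := ⊤)
    (modelWithCornersSelf ℝ E) hK.isClosed hKL
  have hsupp : tsupport f ⊆ L :=
    closure_minimal (fun x hx => by_contra fun hxL => hx (h0 x hxL)) hL.isClosed
  exact ⟨f, ⟨f.contMDiff.contDiff, hL.of_isClosed_subset (isClosed_tsupport _) hsupp,
    hsupp.trans hLΩ⟩, h01, h1⟩

/-- The indicator function of a compact subset of `Ω` is a pointwise limit of test functions with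
values in `[0, 1]` that are supported in a common compact subset of `Ω`. -/
theorem exists_seq_isTestFunction_tendsto_indicator {Ω K : Set E} (hΩ : IsOpen Ω)
    (hK : IsCompact K) (hKΩ : K ⊆ Ω) :
    ∃ (L : Set E) (φ : ℕ → E → ℝ), IsCompact L ∧ L ⊆ Ω ∧ K ⊆ L ∧ (∀ k, IsTestFunction Ω (φ k)) ∧
      (∀ k, tsupport (φ k) ⊆ L) ∧ (∀ k x, φ k x ∈ Icc (0 : ℝ) 1) ∧
      ∀ x, Tendsto (fun k => φ k x) atTop (𝓝 (K.indicator 1 x)) := by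
  obtain ⟨L, hL, hKL, hLΩ⟩ := exists_compact_between hK hΩ hKΩ
  have hU : ∀ k : ℕ, ∃ ψ : E → ℝ,
      IsTestFunction (interior L ∩ Metric.thickening (1 / ((k : ℝ) + 1)) K) ψ ∧
      (∀ x, ψ x ∈ Icc (0 : ℝ) 1) ∧ ∀ᶠ x in 𝓝ˢ K, ψ x = 1 := fun k =>
    exists_isTestFunction_one_nhdsSet (isOpen_interior.inter Metric.isOpen_thickening) hK
      (subset_inter hKL (Metric.self_subset_thickening (by positivity) K))
  choose φ hφ h01 h1 using hU
  have hsub : ∀ k, tsupport (φ k) ⊆ L := fun k =>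
    ((hφ k).tsupport_subset.trans inter_subset_left).trans interior_subset
  refine ⟨L, φ, hL, hLΩ, hKL.trans interior_subset, fun k => ⟨(hφ k).contDiff,
    (hφ k).hasCompactSupport, (hsub k).trans hLΩ⟩, hsub, h01, fun x => ?_⟩
  by_cases hx : x ∈ K
  · simp [hx, fun k => (h1 k).self_of_nhdsSet x hx]
  · rw [indicator_of_notMem hx]
    refine tendsto_const_nhds.congr' ?_
    have hlim : ∀ᶠ k : ℕ in atTop, x ∉ Metric.thickening (1 / ((k : ℝ) + 1)) K := by
      have hpos : 0 < Metric.infEDist x K := by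
        rwa [pos_iff_ne_zero, ne_eq, ← Metric.mem_closure_iff_infEDist_zero,
          hK.isClosed.closure_eq]
      have := (ENNReal.tendsto_ofReal tendsto_one_div_add_atTop_nhds_zero_nat).eventually_lt_const
        (by simpa using hpos)
      filter_upwards [this] with k hk
      rw [Metric.mem_thickening_iff_infEDist_lt]
      exact hk.le.not_gt
    filter_upwards [hlim] with k hk
    by_contra hne
    exact hk ((hφ k).tsupport_subset (subset_tsupport _ (Ne.symm hne))).2

end TestFunctions

/-! ### Positive distributions are measures -/

section PositiveDistributions

variable {E : Type*} [NormedAddCommGroup E] [NormedSpace ℝ E] [FiniteDimensional ℝ E]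
  [MeasurableSpace E] [BorelSpace E]

open scoped CompactlySupported

/-- A positive linear functional on test functions is integration against a measure. The M. Riesz
extension theorem extends the functional to a positive functional on continuous functions with
compact support, to which the Riesz-Markov-Kakutani theorem applies. -/
theorem exists_measure_eq_of_nonneg {Ω : Set E} (hΩ : IsOpen Ω) (T : (E → ℝ) → ℝ)
    (hadd : ∀ φ ψ, IsTestFunction Ω φ → IsTestFunction Ω ψ → T (φ + ψ) = T φ + T ψ)
    (hsmul : ∀ (c : ℝ) (φ), IsTestFunction Ω φ → T (c • φ) = c * T φ)
    (hpos : ∀ φ, IsTestFunction Ω φ → (∀ x, 0 ≤ φ x) → 0 ≤ T φ) :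
    ∃ m : Measure E, (∀ K, IsCompact K → K ⊆ Ω → m K < ⊤) ∧
      ∀ φ, IsTestFunction Ω φ → ∫ x, φ x ∂m = T φ := by
  have : LocallyCompactSpace Ω := hΩ.locallyCompactSpace
  let ext : C_c(Ω, ℝ) → E → ℝ := fun f => Function.extend Subtype.val f 0
  have ext_val : ∀ (f : C_c(Ω, ℝ)) (x : Ω), ext f x = f x := fun f x =>
    Subtype.val_injective.extend_apply _ _ _
  have ext_out : ∀ (f : C_c(Ω, ℝ)) (x : E), x ∉ Ω → ext f x = 0 := fun f x hx =>
    Function.extend_apply' _ _ _ (by rintro ⟨a, rfl⟩; exact hx a.2)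
  have ext_add : ∀ f g, ext (f + g) = ext f + ext g := by
    intro f g
    funext x
    by_cases hx : x ∈ Ω
    · simp [ext_val _ ⟨x, hx⟩]
    · simp [ext_out _ x hx]
  have ext_smul : ∀ (c : ℝ) f, ext (c • f) = c • ext f := by
    intro c f
    funext x
    by_cases hx : x ∈ Ω
    · simp [ext_val _ ⟨x, hx⟩]
    · simp [ext_out _ x hx]
  let p : Submodule ℝ C_c(Ω, ℝ) :=
    { carrier := {f | IsTestFunction Ω (ext f)}
      zero_mem' := by
        have : ext 0 = 0 := by simpa using ext_smul 0 0
        change IsTestFunction Ω (ext 0)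
        rw [this]
        exact ⟨contDiff_const, HasCompactSupport.zero, by simp⟩
      add_mem' := fun {f g} hf hg => by
        change IsTestFunction Ω (ext (f + g))
        rw [ext_add]
        exact IsTestFunction.add hf hg
      smul_mem' := fun c f hf => by
        change IsTestFunction Ω (ext (c • f))
        rw [ext_smul]
        exact IsTestFunction.const_smul hf c }
  let T' : C_c(Ω, ℝ) →ₗ.[ℝ] ℝ :=
    { domain := p
      toFun :=
        { toFun := fun f => T (ext f)
          map_add' := fun f g => by
            rw [Submodule.coe_add, ext_add]
            exact hadd _ _ f.2 g.2
          map_smul' := fun c f => by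
            rw [Submodule.coe_smul, ext_smul]
            exact hsmul _ _ f.2 } }
  let s : PointedCone ℝ C_c(Ω, ℝ) :=
    { carrier := {f | 0 ≤ f}
      zero_mem' := le_refl (0 : C_c(Ω, ℝ))
      add_mem' := fun hf hg x => add_nonneg (hf x) (hg x)
      smul_mem' := fun c f hf x => mul_nonneg c.2 (hf x) }
  -- the restriction to `Ω` of a test function
  have hrestr : ∀ φ, IsTestFunction Ω φ → ∃ f : C_c(Ω, ℝ), ext f = φ := by
    intro φ hφ
    have hcs : HasCompactSupport (fun x : Ω => φ x) := by
      refine HasCompactSupport.of_support_subset_isCompact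
        (K := Subtype.val ⁻¹' tsupport φ) ?_ (fun x hx => subset_tsupport _ hx)
      rw [Topology.IsInducing.subtypeVal.isCompact_preimage_iff]
      · exact hφ.hasCompactSupport
      · simpa using hφ.tsupport_subset
    refine ⟨⟨⟨fun x => φ x, hφ.contDiff.continuous.comp continuous_subtype_val⟩, hcs⟩, ?_⟩
    funext x
    by_cases hx : x ∈ Ω
    · exact ext_val _ ⟨x, hx⟩
    · rw [ext_out _ x hx]
      exact (image_eq_zero_of_notMem_tsupport fun h => hx (hφ.tsupport_subset h)).symm
  obtain ⟨Λ, hΛp, hΛs⟩ := riesz_extension s T'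
    (fun f hf => by
      refine hpos _ f.2 fun x => ?_
      have hf' : (0 : C_c(Ω, ℝ)) ≤ f := hf
      by_cases hx : x ∈ Ω
      · rw [ext_val _ ⟨x, hx⟩]
        exact hf' _
      · rw [ext_out _ x hx])
    (fun f => by
      obtain ⟨ψ, hψ, h01, hψ1⟩ := exists_isTestFunction_one_nhdsSet hΩ
        (f.hasCompactSupport.isCompact.image continuous_subtype_val)
        (Subtype.coe_image_subset _ _)
      obtain ⟨C, hC⟩ := f.hasCompactSupport.exists_bound_of_continuous f.continuous
      obtain ⟨g, hg⟩ := hrestr _ (hψ.const_smul C)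
      refine ⟨⟨g, by change IsTestFunction Ω (ext g); rw [hg]; exact hψ.const_smul C⟩, ?_⟩
      change (0 : C_c(Ω, ℝ)) ≤ g + f
      intro x
      have hgx : g x = C * ψ x := by rw [← ext_val, hg]; rfl
      have hC0 : 0 ≤ C := (norm_nonneg _).trans (hC x)
      change 0 ≤ g x + f x
      rw [hgx]
      by_cases hx : x ∈ tsupport f
      · rw [hψ1.self_of_nhdsSet x ⟨x, hx, rfl⟩]
        have := neg_le_of_abs_le (hC x)
        linarith
      · rw [image_eq_zero_of_notMem_tsupport hx]
        have := mul_nonneg hC0 (h01 x).1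
        linarith)
  let Λ' : C_c(Ω, ℝ) →ₚ[ℝ] ℝ := PositiveLinearMap.mk₀ Λ fun f hf => hΛs f hf
  let m := RealRMK.rieszMeasure Λ'
  have hemb : MeasurableEmbedding (Subtype.val : Ω → E) :=
    MeasurableEmbedding.subtype_coe hΩ.measurableSet
  refine ⟨m.map Subtype.val, fun K hK hKΩ => ?_, fun φ hφ => ?_⟩
  · rw [hemb.map_apply]
    refine IsCompact.measure_lt_top ?_
    rw [Topology.IsInducing.subtypeVal.isCompact_preimage_iff]
    · exact hK
    · simpa using hKΩ
  · rw [hemb.integral_map]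
    obtain ⟨f, hf⟩ := hrestr φ hφ
    have h1 : ∀ x : Ω, φ x = f x := fun x => by rw [← ext_val, hf]
    simp_rw [h1]
    rw [RealRMK.integral_rieszMeasure Λ' f]
    have hmem : f ∈ p := by
      change IsTestFunction Ω (ext f)
      rwa [hf]
    exact (hΛp ⟨f, hmem⟩).trans (congrArg T hf)

end PositiveDistributions

/-! ### Set functions on relatively compact Borel sets -/

section SetFunctions

variable {n : ℕ} {Ω : Set (QSpace n)}

theorem RelCompactBorel.of_isCompact {K : Set (QSpace n)} (hK : IsCompact K) (hKΩ : K ⊆ Ω) :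
    RelCompactBorel Ω K :=
  ⟨hK.isClosed.measurableSet, K, hK, hKΩ, Subset.rfl⟩

theorem RelCompactBorel.mono {A B : Set (QSpace n)} (hB : RelCompactBorel Ω B)
    (hA : MeasurableSet A) (hAB : A ⊆ B) : RelCompactBorel Ω A := by
  obtain ⟨-, K, hK, hKΩ, hBK⟩ := hB
  exact ⟨hA, K, hK, hKΩ, hAB.trans hBK⟩

/-- A countably additive set function on the relatively compact Borel sets vanishes if it vanishes
on the compact sets. -/
theorem RelCompactBorel.eq_zero_of_forall_isCompact {V : Type*} [AddCommGroup V]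
    [TopologicalSpace V] [T2Space V] (F : Set (QSpace n) → V)
    (hF : ∀ A : ℕ → Set (QSpace n), (∀ k, MeasurableSet (A k)) →
      Pairwise (fun k l => Disjoint (A k) (A l)) → RelCompactBorel Ω (⋃ k, A k) →
      HasSum (fun k => F (A k)) (F (⋃ k, A k)))
    (hF0 : ∀ K, IsCompact K → K ⊆ Ω → F K = 0) {A : Set (QSpace n)} (hA : RelCompactBorel Ω A) :
    F A = 0 := by
  obtain ⟨hAm, K, hK, hKΩ, hAK⟩ := hA
  have hKm : MeasurableSet K := hK.isClosed.measurableSet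
  have hempty : F ∅ = 0 := hF0 ∅ isCompact_empty (empty_subset _)
  have key : ∀ B, MeasurableSet B → F (B ∩ K) = 0 := by
    intro B hB
    induction B, hB using MeasurableSpace.induction_on_inter
      (BorelSpace.measurable_eq.trans (borel_eq_generateFrom_isClosed (α := QSpace n)))
      isPiSystem_isClosed with
    | empty => rw [empty_inter, hempty]
    | basic t ht =>
      exact hF0 _ (hK.inter_left (show IsClosed t from ht)) (inter_subset_right.trans hKΩ)
    | compl t ht ih =>
      -- additivity on `K = (tᶜ ∩ K) ∪ (t ∩ K)`, written as a countable disjoint union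
      let S : ℕ → Set (QSpace n) := fun k => if k = 0 then tᶜ ∩ K else if k = 1 then t ∩ K else ∅
      have hU : ⋃ k, S k = K := by
        ext x
        simp only [mem_iUnion, S]
        constructor
        · rintro ⟨k, hk⟩
          split_ifs at hk
          exacts [hk.2, hk.2, hk.elim]
        · intro hx
          by_cases hxt : x ∈ t
          · exact ⟨1, by simp [hx, hxt]⟩
          · exact ⟨0, by simp [hx, hxt]⟩
      have hsum := hF S (fun k => by
          simp only [S]
          split_ifs
          exacts [ht.compl.inter hKm, ht.inter hKm, MeasurableSet.empty])
        (fun k l hkl => by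
          have hd : Disjoint (tᶜ ∩ K) (t ∩ K) :=
            disjoint_compl_left.mono inter_subset_left inter_subset_left
          simp only [S]
          split_ifs <;> first | exact (hkl (by omega)).elim | exact hd | exact hd.symm | simp)
        (by rw [hU]; exact .of_isCompact hK hKΩ)
      rw [hU, hF0 K hK hKΩ] at hsum
      have h0 : HasSum (fun k => F (S k)) (F (S 0)) := by
        refine hasSum_single 0 fun k hk => ?_
        simp only [S, if_neg hk]
        split_ifs
        exacts [ih, hempty]
      exact h0.unique hsum
    | iUnion f hd hf ih =>
      rw [iUnion_inter]
      have hsum := hF (fun k => f k ∩ K) (fun k => (hf k).inter hKm)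
        (fun k l hkl => (hd hkl).mono inter_subset_left inter_subset_left)
        ⟨MeasurableSet.iUnion fun k => (hf k).inter hKm, K, hK, hKΩ,
          iUnion_subset fun k => inter_subset_right⟩
      simp only [ih] at hsum
      exact hsum.unique hasSum_zero
  rw [← inter_eq_self_of_subset_left hAK]
  exact key A hAm

end SetFunctions

/-! ### Hyperhermitian measures are determined by their integrals -/

@[simp] theorem re_quatUnit (a : Fin 4) : (quatUnit a).re = (![1, 0, 0, 0] : Fin 4 → ℝ) a := by
  fin_cases a <;> rfl

@[simp] theorem imI_quatUnit (a : Fin 4) : (quatUnit a).imI = (![0, 1, 0, 0] : Fin 4 → ℝ) a := by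
  fin_cases a <;> rfl

@[simp] theorem imJ_quatUnit (a : Fin 4) : (quatUnit a).imJ = (![0, 0, 1, 0] : Fin 4 → ℝ) a := by
  fin_cases a <;> rfl

@[simp] theorem imK_quatUnit (a : Fin 4) : (quatUnit a).imK = (![0, 0, 0, 1] : Fin 4 → ℝ) a := by
  fin_cases a <;> rfl

theorem inner_quatUnit_left (a : Fin 4) (q : ℍ) :
    inner ℝ (quatUnit a) q = (![q.re, q.imI, q.imJ, q.imK] : Fin 4 → ℝ) a := by
  rw [Quaternion.inner_def, Quaternion.re_mul]
  fin_cases a <;> simp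

theorem inner_quatUnit (a b : Fin 4) :
    inner ℝ (quatUnit a) (quatUnit b) = if a = b then 1 else 0 := by
  rw [inner_quatUnit_left]
  fin_cases a <;> fin_cases b <;> simp

theorem inner_quatUnit_sum_smul (c : Fin 4 → ℝ) (a : Fin 4) :
    inner ℝ (quatUnit a) (∑ b, c b • quatUnit b) = c a := by
  simp only [inner_sum, inner_smul_right, inner_quatUnit]
  simp

theorem sum_inner_quatUnit_smul (q : ℍ) : ∑ a, inner ℝ (quatUnit a) q • quatUnit a = q := by
  simp only [inner_quatUnit_left, Fin.sum_univ_four]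
  ext <;> simp

instance isFiniteMeasure_variation_signedMeasure {α : Type*} [MeasurableSpace α]
    (s : SignedMeasure α) : IsFiniteMeasure s.variation := by
  rw [← SignedMeasure.totalVariation_eq_variation]
  infer_instance

namespace HyperhermitianMeasure

variable {n : ℕ} {Ω : Set (QSpace n)}

theorem entryMeasure_apply (μ : HyperhermitianMeasure Ω) {K : Set (QSpace n)} (hK : IsCompact K)
    (hKΩ : K ⊆ Ω) (i j : Fin n) (a : Fin 4) {A : Set (QSpace n)} (hA : MeasurableSet A) :
    μ.entryMeasure K hK hKΩ i j a A = inner ℝ (quatUnit a) (μ.val (A ∩ K) i j) := by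
  rw [entryMeasure, VectorMeasure.mapRange_apply]
  have h : μ.toVectorMeasure K hK hKΩ A = μ.val (A ∩ K) := if_pos hA
  rw [h]
  rfl

/-- The integral may be computed on any compact set that contains the support. -/
theorem inner_integral_eq (μ : HyperhermitianMeasure Ω) {φ : QSpace n → ℝ}
    (hφ : HasCompactSupport φ) (hφΩ : tsupport φ ⊆ Ω) {K : Set (QSpace n)} (hK : IsCompact K)
    (hKΩ : K ⊆ Ω) (hφK : tsupport φ ⊆ K) (i j : Fin n) (a : Fin 4) :
    inner ℝ (quatUnit a) (μ.integral φ hφ hφΩ i j) =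
      ∫ᵛ z, φ z ∂•(μ.entryMeasure K hK hKΩ i j a) := by
  have hm : MeasurableSet (tsupport φ) := (isClosed_tsupport φ).measurableSet
  have hrestr : μ.entryMeasure (tsupport φ) hφ.isCompact hφΩ i j a =
      (μ.entryMeasure K hK hKΩ i j a).restrict (tsupport φ) := by
    ext A hA
    rw [VectorMeasure.restrict_apply _ hm hA, entryMeasure_apply _ _ _ _ _ _ hA,
      entryMeasure_apply _ _ _ _ _ _ (hA.inter hm), inter_assoc,
      inter_eq_self_of_subset_left hφK]
  have h : inner ℝ (quatUnit a) (μ.integral φ hφ hφΩ i j) =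
      ∫ᵛ z, φ z ∂•(μ.entryMeasure (tsupport φ) hφ.isCompact hφΩ i j a) :=
    inner_quatUnit_sum_smul
      (fun b => ∫ᵛ z, φ z ∂•(μ.entryMeasure (tsupport φ) hφ.isCompact hφΩ i j b)) a
  rw [h, hrestr, ← VectorMeasure.integral_indicator hm]
  have hind : (tsupport φ).indicator (fun z => φ z) = φ :=
    indicator_eq_self.2 (subset_tsupport φ)
  rw [hind]

/-- A hyperhermitian measure is determined by its integrals of test functions. -/
theorem ext_of_integral_eq (hΩ : IsOpen Ω) {μ ν : HyperhermitianMeasure Ω}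
    (h : ∀ φ, IsTestFunction Ω φ → ∀ hφ hφΩ, ∀ i j,
      μ.integral φ hφ hφΩ i j = ν.integral φ hφ hφΩ i j) : μ = ν := by
  suffices hval : ∀ A, RelCompactBorel Ω A → μ.val A = ν.val A by
    ext1
    funext A
    by_cases hA : RelCompactBorel Ω A
    · exact hval A hA
    · rw [μ.eq_zero A hA, ν.eq_zero A hA]
  intro A hA
  refine sub_eq_zero.1 (RelCompactBorel.eq_zero_of_forall_isCompact (Ω := Ω)
    (fun A => μ.val A - ν.val A)
    (fun B hB hd hU => (μ.hasSum B hB hd hU).sub (ν.hasSum B hB hd hU)) (fun K hK hKΩ => ?_) hA)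
  obtain ⟨L, φ, hL, hLΩ, hKL, hφ, hφL, h01, hlim⟩ :=
    exists_seq_isTestFunction_tendsto_indicator hΩ hK hKΩ
  have hKm : MeasurableSet K := hK.isClosed.measurableSet
  have key : ∀ (ρ : HyperhermitianMeasure Ω) (i j : Fin n) (a : Fin 4),
      Tendsto (fun k => inner ℝ (quatUnit a)
        (ρ.integral (φ k) (hφ k).hasCompactSupport (hφ k).tsupport_subset i j)) atTop
        (𝓝 (inner ℝ (quatUnit a) (ρ.val K i j))) := by
    intro ρ i j a
    have hlimit : ∫ᵛ z, K.indicator (1 : QSpace n → ℝ) z ∂•(ρ.entryMeasure L hL hLΩ i j a) =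
        inner ℝ (quatUnit a) (ρ.val K i j) := by
      rw [VectorMeasure.integral_indicator hKm]
      simp only [Pi.one_apply]
      rw [VectorMeasure.integral_const]
      simp [VectorMeasure.restrict_apply, hKm, entryMeasure_apply,
        inter_eq_self_of_subset_left hKL]
    rw [← hlimit]
    simp_rw [fun k => ρ.inner_integral_eq (hφ k).hasCompactSupport (hφ k).tsupport_subset hL hLΩ
      (hφL k) i j a]
    refine VectorMeasure.tendsto_integral_of_dominated_convergence (fun _ => 1)
      (fun k => (hφ k).contDiff.continuous.aestronglyMeasurable) (integrable_const _)
      (fun k => .of_forall fun z => ?_) (.of_forall hlim)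
    rw [Real.norm_eq_abs, abs_of_nonneg (h01 k z).1]
    exact (h01 k z).2
  rw [sub_eq_zero]
  ext1 i j
  rw [← sum_inner_quatUnit_smul (μ.val K i j), ← sum_inner_quatUnit_smul (ν.val K i j)]
  congr 1 with a : 1
  congr 1
  refine tendsto_nhds_unique (key μ i j a) ((key ν i j a).congr fun k => ?_)
  rw [h (φ k) (hφ k)]

end HyperhermitianMeasure

/-! ### The quaternionic Hessian as a quadratic form -/

section QuadraticForm

variable {n : ℕ}

/-- The value at `ξ` of the real quadratic form `ξ ↦ Re (ξ* A ξ)` of a quaternionic matrix. -/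
def quatForm (A : Matrix (Fin n) (Fin n) ℍ) (ξ : Fin n → ℍ) : ℝ :=
  (∑ i, ∑ j, star (ξ i) * A i j * ξ j).re

/-- The Laplacian at `q = 0` of the restriction `q ↦ f (z + ξ q)` to a right quaternionic line. -/
def lineLaplacian (ξ : Fin n → ℍ) (f : QSpace n → ℝ) (z : QSpace n) : ℝ :=
  ∑ c, fderiv ℝ (fderiv ℝ f) z (fun i => ξ i * quatUnit c) (fun i => ξ i * quatUnit c)

theorem quatHessian_apply {f : QSpace n → ℝ} {z : QSpace n} (hf : ContDiffAt ℝ 2 f z)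
    (i j : Fin n) :
    quatHessian f z i j = ∑ a, ∑ b, fderiv ℝ (fderiv ℝ f) z (Pi.single i (quatUnit a))
      (Pi.single j (quatUnit b)) • (quatUnit a * star (quatUnit b)) := by
  have hd : ∀ᶠ w in 𝓝 z, DifferentiableAt ℝ f w := by
    filter_upwards [hf.eventually (by simp)] with w hw
    exact hw.differentiableAt (by norm_num)
  have hdd : DifferentiableAt ℝ (fderiv ℝ f) z :=
    (hf.fderiv_right (m := 1) (by norm_num)).differentiableAt (by norm_num)
  have hD : quatD j (fun w => (f w : ℍ)) =ᶠ[𝓝 z]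
      fun w => ∑ b, fderiv ℝ f w (Pi.single j (quatUnit b)) • star (quatUnit b) := by
    filter_upwards [hd] with w hw
    have h1 : HasFDerivAt (fun w => star (f w : ℍ)) ((fderiv ℝ f w).smulRight (1 : ℍ)) w := by
      have := hw.hasFDerivAt.smul_const (1 : ℍ)
      refine this.congr_of_eventuallyEq (.of_forall fun x => ?_)
      ext <;> simp
    simp only [quatD, quatDbar, quatPartial, h1.fderiv, star_sum,
      ContinuousLinearMap.smulRight_apply, mul_smul_comm, mul_one, Quaternion.star_smul]
  have h2 : HasFDerivAt (fun w => ∑ b, fderiv ℝ f w (Pi.single j (quatUnit b)) • star (quatUnit b))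
      (∑ b, ((fderiv ℝ (fderiv ℝ f) z).flip (Pi.single j (quatUnit b))).smulRight
        (star (quatUnit b))) z := by
    refine HasFDerivAt.fun_sum fun b _ => HasFDerivAt.smul_const ?_ _
    have := hdd.hasFDerivAt.clm_apply (hasFDerivAt_const (Pi.single j (quatUnit b)) z)
    rwa [ContinuousLinearMap.comp_zero, zero_add] at this
  simp only [quatHessian, Matrix.of_apply, quatDbar, quatPartial]
  refine Finset.sum_congr rfl fun a _ => ?_
  rw [(h2.congr_of_eventuallyEq hD).fderiv, _root_.sum_apply, Finset.mul_sum]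
  refine Finset.sum_congr rfl fun b _ => ?_
  simp only [ContinuousLinearMap.smulRight_apply, ContinuousLinearMap.flip_apply, mul_smul_comm]

theorem isHermitian_quatHessian {f : QSpace n → ℝ} {z : QSpace n} (hf : ContDiffAt ℝ 2 f z) :
    (quatHessian f z).IsHermitian := by
  have hsymm : IsSymmSndFDerivAt ℝ f z := hf.isSymmSndFDerivAt (by simp)
  ext1 i j
  rw [Matrix.conjTranspose_apply, quatHessian_apply hf, quatHessian_apply hf, Finset.sum_comm,
    star_sum]
  refine Finset.sum_congr rfl fun a _ => ?_
  rw [star_sum]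
  refine Finset.sum_congr rfl fun b _ => ?_
  rw [Quaternion.star_smul, star_mul, star_star, hsymm.eq]

theorem sum_inner_mul_inner (p q : ℍ) (a b : Fin 4) :
    ∑ c, inner ℝ (quatUnit a) (p * quatUnit c) * inner ℝ (quatUnit b) (q * quatUnit c) =
      (star p * (quatUnit a * star (quatUnit b)) * q).re := by
  simp only [inner_quatUnit_left, Fin.sum_univ_four]
  fin_cases a <;> fin_cases b <;> simp <;> ring

theorem sum_inner_smul_single (v : QSpace n) :
    ∑ p : Fin n × Fin 4, inner ℝ (quatUnit p.2) (v p.1) •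
      (Pi.single p.1 (quatUnit p.2) : QSpace n) = v := by
  funext k
  rw [Fintype.sum_prod_type, Finset.sum_apply, Finset.sum_eq_single k]
  · simpa using sum_inner_quatUnit_smul (v k)
  · intro i _ hi
    simp [Pi.single_eq_of_ne' hi]
  · simp

theorem bilin_eq_sum_single (B : QSpace n →L[ℝ] QSpace n →L[ℝ] ℝ) (v : QSpace n) :
    B v v = ∑ p : Fin n × Fin 4, ∑ q : Fin n × Fin 4,
      B (Pi.single p.1 (quatUnit p.2)) (Pi.single q.1 (quatUnit q.2)) *
        (inner ℝ (quatUnit p.2) (v p.1) * inner ℝ (quatUnit q.2) (v q.1)) := by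
  conv_lhs => rw [← sum_inner_smul_single v]
  simp only [map_sum, map_smul, _root_.sum_apply, _root_.smul_apply, smul_eq_mul, Finset.mul_sum]
  rw [Finset.sum_comm]
  refine Finset.sum_congr rfl fun p _ => Finset.sum_congr rfl fun q _ => ?_
  ring

theorem quatForm_quatHessian {f : QSpace n → ℝ} {z : QSpace n} (hf : ContDiffAt ℝ 2 f z)
    (ξ : Fin n → ℍ) : quatForm (quatHessian f z) ξ = lineLaplacian ξ f z := by
  have hre : ∀ {ι : Type} (s : Finset ι) (g : ι → ℍ), (∑ k ∈ s, g k).re = ∑ k ∈ s, (g k).re :=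
    fun s g => map_sum (AddMonoidHom.mk' (fun q : ℍ => q.re) fun _ _ => rfl) g s
  simp only [lineLaplacian, bilin_eq_sum_single]
  rw [Finset.sum_comm]
  simp_rw [Finset.sum_comm (s := (Finset.univ : Finset (Fin 4)))
    (t := (Finset.univ : Finset (Fin n × Fin 4))), ← Finset.mul_sum, sum_inner_mul_inner,
    Fintype.sum_prod_type]
  simp only [quatForm, hre]
  refine Finset.sum_congr rfl fun i _ => ?_
  rw [Finset.sum_comm]
  refine Finset.sum_congr rfl fun j _ => ?_
  rw [quatHessian_apply hf, Finset.mul_sum, Finset.sum_mul, hre]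
  refine Finset.sum_congr rfl fun a _ => ?_
  rw [Finset.mul_sum, Finset.sum_mul, hre]
  refine Finset.sum_congr rfl fun b _ => ?_
  rw [mul_smul_comm, smul_mul_assoc, Quaternion.re_smul, smul_eq_mul]

theorem quatForm_add (A : Matrix (Fin n) (Fin n) ℍ) (ξ η : Fin n → ℍ) :
    quatForm A (ξ + η) = quatForm A ξ + quatForm A η +
      ((∑ i, ∑ j, star (ξ i) * A i j * η j).re + (∑ i, ∑ j, star (η i) * A i j * ξ j).re) := by
  simp only [quatForm, ← Quaternion.re_add, ← Finset.sum_add_distrib]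
  congr 1
  refine Finset.sum_congr rfl fun i _ => Finset.sum_congr rfl fun j _ => ?_
  simp only [Pi.add_apply, star_add]
  noncomm_ring

theorem sum_single_mul_single (A : Matrix (Fin n) (Fin n) ℍ) (i j : Fin n) (p q : ℍ) :
    ∑ k, ∑ l, star ((Pi.single i p : Fin n → ℍ) k) * A k l * (Pi.single j q : Fin n → ℍ) l =
      star p * A i j * q := by
  rw [Finset.sum_eq_single i (fun k _ hk => by simp [hk]) (by simp),
    Finset.sum_eq_single j (fun k _ hk => by simp [hk]) (by simp)]
  simp

/-- Recovers a hyperhermitian matrix `A` from finitely many values of its quadratic form: the cross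
term of the form at `ξ = (e_c at i)` and `η = (1 at j)` is `2 ⟪e_c, A i j⟫`. -/
def polarize : ((Fin n → ℍ) → ℝ) →L[ℝ] Matrix (Fin n) (Fin n) ℍ where
  toFun g := Matrix.of fun i j => ∑ c, ((1 / 2 : ℝ) *
    (g (Pi.single i (quatUnit c) + Pi.single j 1) - g (Pi.single i (quatUnit c)) -
      g (Pi.single j 1))) • quatUnit c
  map_add' g h := by
    ext1 i j
    simp only [Pi.add_apply, Matrix.of_apply, Matrix.add_apply, ← Finset.sum_add_distrib,
      ← add_smul]
    congr 1 with c : 1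
    congr 1
    ring
  map_smul' r g := by
    ext1 i j
    simp only [Pi.smul_apply, Matrix.of_apply, Matrix.smul_apply, Finset.smul_sum, smul_smul,
      smul_eq_mul, RingHom.id_apply]
    congr 1 with c : 1
    congr 1
    ring
  cont := by
    refine continuous_pi fun i => continuous_pi fun j => ?_
    simp only [Matrix.of_apply]
    fun_prop

theorem polarize_apply (g : (Fin n → ℍ) → ℝ) (i j : Fin n) :
    polarize g i j = ∑ c, ((1 / 2 : ℝ) * (g (Pi.single i (quatUnit c) + Pi.single j 1) -
      g (Pi.single i (quatUnit c)) - g (Pi.single j 1))) • quatUnit c := rfl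

theorem polarize_quatForm {A : Matrix (Fin n) (Fin n) ℍ} (hA : A.IsHermitian) :
    polarize (quatForm A) = A := by
  ext1 i j
  rw [polarize_apply, ← sum_inner_quatUnit_smul (A i j)]
  congr 1 with c : 1
  congr 1
  rw [quatForm_add, sum_single_mul_single, sum_single_mul_single, ← hA.apply j i,
    Quaternion.inner_def]
  simp only [Quaternion.re_mul, Quaternion.re_star, Quaternion.imI_star, Quaternion.imJ_star,
    Quaternion.imK_star, Quaternion.imI_mul, Quaternion.imJ_mul, Quaternion.imK_mul,
    Quaternion.re_one, Quaternion.imI_one, Quaternion.imJ_one, Quaternion.imK_one, star_one]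
  ring

theorem polarize_lineLaplacian {f : QSpace n → ℝ} {z : QSpace n} (hf : ContDiffAt ℝ 2 f z) :
    polarize (fun ξ => lineLaplacian ξ f z) = quatHessian f z := by
  simp_rw [← quatForm_quatHessian hf]
  exact polarize_quatForm (isHermitian_quatHessian hf)

end QuadraticForm

/-! ### Local integrability of plurisubharmonic functions -/

section LocalIntegrability

theorem UpperSemicontinuousOn.measurable_indicator {X : Type*} [TopologicalSpace X]
    [MeasurableSpace X] [BorelSpace X] {s t : Set X} {u : X → ℝ} (hu : UpperSemicontinuousOn u s)
    (ht : MeasurableSet t) (hts : t ⊆ s) : Measurable (t.indicator u) := by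
  classical
  have h1 : UpperSemicontinuous (t.domRestrict u) := by
    rw [upperSemicontinuousOn_iff_restrict]
    exact hu.mono hts
  have h2 : t.indicator u = fun x => if h : x ∈ t then t.domRestrict u ⟨x, h⟩ else 0 := by
    funext x
    by_cases hx : x ∈ t <;> simp [hx]
  rw [h2]
  exact Measurable.dite (f := t.domRestrict u) (g := fun _ => (0 : ℝ)) h1.measurable
    measurable_const ht

theorem SubharmonicOnQuat.lintegral_sub_le {U : Set ℍ} {g : ℍ → ℝ} (hg : SubharmonicOnQuat U g)
    {a : ℍ} {r : ℝ} (hr : 0 < r) (hU : Metric.closedBall a r ⊆ U) {M : ℝ}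
    (hM : ∀ q ∈ Metric.closedBall a r, g q ≤ M) :
    ∫⁻ q in Metric.closedBall a r, ENNReal.ofReal (M - g q) ≤
      volume (Metric.closedBall a r) * ENNReal.ofReal (M - g a) := by
  have hfin : volume (Metric.closedBall a r) ≠ ⊤ := measure_closedBall_lt_top.ne
  have hpos : 0 < volume.real (Metric.closedBall a r) :=
    ENNReal.toReal_pos (Metric.measure_closedBall_pos volume a hr).ne' hfin
  have hint := hg.integrableOn a r hr hU
  have hconst : IntegrableOn (fun _ : ℍ => M) (Metric.closedBall a r) := integrableOn_const hfin
  rw [← ofReal_integral_eq_lintegral_ofReal (f := fun q => M - g q) (hconst.sub hint)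
    ((ae_restrict_iff' Metric.isClosed_closedBall.measurableSet).2
      (.of_forall fun q hq => sub_nonneg.2 (hM q hq))), integral_sub hconst hint,
    ← ENNReal.ofReal_toReal hfin, ← ENNReal.ofReal_mul ENNReal.toReal_nonneg]
  refine ENNReal.ofReal_le_ofReal ?_
  have havg := hg.le_average a r hr hU
  rw [setAverage_eq, smul_eq_mul, inv_mul_eq_div, le_div_iff₀ hpos] at havg
  have h1 : ∫ _ in Metric.closedBall a r, M = volume.real (Metric.closedBall a r) * M := by simp
  have h2 : (volume (Metric.closedBall a r)).toReal = volume.real (Metric.closedBall a r) := rfl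
  rw [h1, h2]
  linarith

variable {n : ℕ} {Ω : Set (QSpace n)} {u : QSpace n → ℝ}

open scoped ENNReal in
/-- Iterating the sub-mean value inequality over the coordinates bounds the integral of `M - u`
over a polydisc by its value at the centre, which is finite. -/
theorem QuatPsh.integrableOn_closedBall (hu : QuatPsh Ω u) {z : QSpace n} {r : ℝ} (hr : 0 < r)
    (hz : Metric.closedBall z r ⊆ Ω) : IntegrableOn u (Metric.closedBall z r) := by
  classical
  have hBm : MeasurableSet (Metric.closedBall z r) := Metric.isClosed_closedBall.measurableSet
  obtain ⟨M, hM⟩ := (hu.usc.mono hz).bddAbove_of_isCompact (isCompact_closedBall z r)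
  have hM' : ∀ x ∈ Metric.closedBall z r, u x ≤ M := fun x hx => hM ⟨x, hx, rfl⟩
  have humeas : Measurable ((Metric.closedBall z r).indicator u) :=
    hu.usc.measurable_indicator hBm hz
  let g : QSpace n → ℝ≥0∞ := fun x => ENNReal.ofReal (M - (Metric.closedBall z r).indicator u x)
  have hg : Measurable g := (measurable_const.sub humeas).ennreal_ofReal
  let μ : ∀ i : Fin n, Measure ℍ := fun i => volume.restrict (Metric.closedBall (z i) r)
  have key : ∀ (s : Finset (Fin n)) (x : QSpace n), x ∈ Metric.closedBall z r →
      (∀ i ∈ s, x i = z i) →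
      (∫⋯∫⁻_s, g ∂μ) x ≤ (∏ i ∈ s, volume (Metric.closedBall (z i) r)) * g x := by
    intro s
    induction s using Finset.induction_on with
    | empty => intro x hx _; simp
    | insert i s his ih =>
      intro x hx hxs
      have hup : ∀ q ∈ Metric.closedBall (z i) r,
          Function.update x i q ∈ Metric.closedBall z r := by
        intro q hq
        rw [mem_closedBall_iff_norm, pi_norm_le_iff_of_nonneg hr.le] at hx ⊢
        intro j
        by_cases hj : j = i
        · subst hj
          simpa using mem_closedBall_iff_norm.1 hq
        · simpa [hj] using hx j
      rw [lmarginal_insert _ hg his]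
      have hline : ∀ q, (fun k => Function.update x i 0 k + (Pi.single i 1 : QSpace n) k * q) =
          Function.update x i q := by
        intro q
        funext k
        by_cases hk : k = i
        · subst hk; simp
        · simp [hk]
      have hsub := hu.subharmonic (Function.update x i 0) (Pi.single i 1) (by simp)
      simp only [hline] at hsub
      have hxi : Function.update x i (z i) = x := by
        rw [← hxs i (Finset.mem_insert_self i s), Function.update_eq_self]
      calc ∫⁻ q, (∫⋯∫⁻_s, g ∂μ) (Function.update x i q) ∂(μ i)
          ≤ ∫⁻ q in Metric.closedBall (z i) r, (∏ i ∈ s, volume (Metric.closedBall (z i) r)) *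
              ENNReal.ofReal (M - u (Function.update x i q)) := by
            refine setLIntegral_mono' Metric.isClosed_closedBall.measurableSet fun q hq => ?_
            refine (ih _ (hup q hq) fun j hj => ?_).trans_eq ?_
            · have hji : j ≠ i := fun h => his (h ▸ hj)
              simpa [hji] using hxs j (Finset.mem_insert_of_mem hj)
            · simp only [g, indicator_of_mem (hup q hq)]
        _ = (∏ i ∈ s, volume (Metric.closedBall (z i) r)) *
              ∫⁻ q in Metric.closedBall (z i) r,
                ENNReal.ofReal (M - u (Function.update x i q)) := by
            refine lintegral_const_mul' _ _ ?_
            exact ENNReal.prod_ne_top fun j _ => measure_closedBall_lt_top.ne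
        _ ≤ (∏ i ∈ s, volume (Metric.closedBall (z i) r)) *
              (volume (Metric.closedBall (z i) r) *
                ENNReal.ofReal (M - u (Function.update x i (z i)))) := by
            gcongr
            exact hsub.lintegral_sub_le hr (fun q hq => hz (hup q hq))
              (fun q hq => hM' _ (hup q hq))
        _ = (∏ i ∈ insert i s, volume (Metric.closedBall (z i) r)) * g x := by
            rw [Finset.prod_insert his, hxi]
            simp only [g, indicator_of_mem hx]
            ring
  have hpi : Measure.pi μ = volume.restrict (Metric.closedBall z r) := by
    rw [closedBall_pi z hr.le, volume_pi, Measure.restrict_pi_pi]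
  have hfin : ∫⁻ x in Metric.closedBall z r, g x < ⊤ := by
    rw [← hpi, lintegral_eq_lmarginal_univ z]
    refine (key Finset.univ z (Metric.mem_closedBall_self hr.le) fun _ _ => rfl).trans_lt ?_
    exact ENNReal.mul_lt_top (ENNReal.prod_lt_top fun j _ => measure_closedBall_lt_top)
      ENNReal.ofReal_lt_top
  have hint : IntegrableOn (fun x => M - (Metric.closedBall z r).indicator u x)
      (Metric.closedBall z r) := by
    refine ⟨(measurable_const.sub humeas).aestronglyMeasurable, ?_⟩
    rw [hasFiniteIntegral_iff_ofReal]
    · exact hfin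
    · refine (ae_restrict_iff' hBm).2 (.of_forall fun x hx => ?_)
      simpa [hx] using hM' x hx
  have hconst : IntegrableOn (fun _ : QSpace n => M) (Metric.closedBall z r) :=
    integrableOn_const measure_closedBall_lt_top.ne
  refine (hconst.sub hint).congr_fun (fun x hx => ?_) hBm
  simp [hx]

theorem QuatPsh.locallyIntegrableOn (hu : QuatPsh Ω u) (hΩ : IsOpen Ω) :
    LocallyIntegrableOn u Ω := by
  intro z hz
  obtain ⟨r, hr, hball⟩ := Metric.nhds_basis_closedBall.mem_iff.1 (hΩ.mem_nhds hz)
  exact ⟨Metric.closedBall z r, mem_nhdsWithin_of_mem_nhds (Metric.closedBall_mem_nhds z hr),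
    hu.integrableOn_closedBall hr hball⟩

end LocalIntegrability

/-! ### The sub-mean value inequality implies a non-negative Laplacian -/

section Taylor

variable {E : Type*} [NormedAddCommGroup E] [NormedSpace ℝ E]

open Asymptotics in
theorem ContDiffAt.isLittleO_taylor_two {f : E → ℝ} {z : E} (hf : ContDiffAt ℝ 2 f z) :
    (fun h => f (z + h) - f z - fderiv ℝ f z h - (1 / 2 : ℝ) * fderiv ℝ (fderiv ℝ f) z h h)
      =o[𝓝 0] fun h => ‖h‖ ^ 2 := by
  have hsymm : IsSymmSndFDerivAt ℝ f z := hf.isSymmSndFDerivAt (by simp)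
  have hd : ∀ᶠ w in 𝓝 z, DifferentiableAt ℝ f w := by
    filter_upwards [hf.eventually (by simp)] with w hw
    exact hw.differentiableAt (by norm_num)
  have hdd : DifferentiableAt ℝ (fderiv ℝ f) z :=
    (hf.fderiv_right (m := 1) (by norm_num)).differentiableAt (by norm_num)
  set D := fderiv ℝ (fderiv ℝ f) z
  have hlim : Tendsto (fun h => z + h) (𝓝 (0 : E)) (𝓝 z) := by
    have : Continuous fun h : E => z + h := by fun_prop
    simpa using this.tendsto 0
  have hderiv : ∀ᶠ h in 𝓝 (0 : E),
      HasFDerivAt (fun h => f (z + h) - f z - fderiv ℝ f z h - (1 / 2 : ℝ) * D h h)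
        (fderiv ℝ f (z + h) - fderiv ℝ f z - D h) h := by
    filter_upwards [hlim.eventually hd] with h hh
    have h1 : HasFDerivAt (fun h => f (z + h)) (fderiv ℝ f (z + h)) h :=
      (hasFDerivAt_comp_add_left z).2 hh.hasFDerivAt
    have h2 : HasFDerivAt (fun h => (1 / 2 : ℝ) * D h h) (D h) h := by
      have := ((D.hasFDerivAt (x := h)).clm_apply (hasFDerivAt_id h)).const_mul (1 / 2 : ℝ)
      refine this.congr_fderiv ?_
      ext v
      have hv : D v h = D h v := hsymm.eq v h
      simp [hv]
      ring
    exact ((h1.sub_const _).sub (fderiv ℝ f z).hasFDerivAt).sub h2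
  rw [isLittleO_iff]
  intro ε hε
  have ho : ∀ᶠ h in 𝓝 (0 : E), ‖fderiv ℝ f (z + h) - fderiv ℝ f z - D h‖ ≤ ε * ‖h‖ := by
    have := (hasFDerivAt_iff_isLittleO_nhds_zero.1 hdd.hasFDerivAt)
    exact (isLittleO_iff.1 this) hε
  obtain ⟨δ, hδ, hball⟩ := Metric.eventually_nhds_iff_ball.1 (hderiv.and ho)
  filter_upwards [Metric.ball_mem_nhds (0 : E) hδ] with h hh
  have hsub : Metric.closedBall (0 : E) ‖h‖ ⊆ Metric.ball 0 δ :=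
    Metric.closedBall_subset_ball (by simpa using hh)
  have := (convex_closedBall (0 : E) ‖h‖).norm_image_sub_le_of_norm_hasFDerivWithin_le
    (C := ε * ‖h‖) (fun x hx => ((hball x (hsub hx)).1).hasFDerivWithinAt)
    (fun x hx => ((hball x (hsub hx)).2).trans (by
      have : ‖x‖ ≤ ‖h‖ := by simpa using hx
      gcongr))
    (x := 0) (y := h) (by simp) (by simp)
  simpa [pow_two, mul_assoc] using this

end Taylor

section Laplacian

/-- Left multiplication by a quaternionic unit, as a linear isometry. -/
def quatUnitMulLeft (c : Fin 4) : ℍ ≃ₗᵢ[ℝ] ℍ :=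
  LinearIsometry.toLinearIsometryEquiv
    { toLinearMap := LinearMap.mulLeft ℝ (quatUnit c)
      norm_map' := fun q => by
        have h1 : ‖quatUnit c‖ = 1 := by
          have := inner_quatUnit c c
          rw [real_inner_self_eq_norm_sq, if_pos rfl] at this
          nlinarith [norm_nonneg (quatUnit c)]
        change ‖quatUnit c * q‖ = ‖q‖
        rw [norm_mul, h1, one_mul] } rfl

theorem sum_inner_quatUnit_mul (a b : Fin 4) (q : ℍ) :
    ∑ c, inner ℝ (quatUnit a) (quatUnit c * q) * inner ℝ (quatUnit b) (quatUnit c * q) =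
      if a = b then ‖q‖ ^ 2 else 0 := by
  rw [← real_inner_self_eq_norm_sq, Quaternion.inner_def]
  simp only [inner_quatUnit_left, Fin.sum_univ_four]
  fin_cases a <;> fin_cases b <;> simp <;> ring

/-- For `q ≠ 0` the quaternions `e_c q` are pairwise orthogonal of length `‖q‖`, so that the values
of a bilinear form at them sum up to `‖q‖²` times its trace. -/
theorem sum_bilin_quatUnit_mul (B : ℍ →L[ℝ] ℍ →L[ℝ] ℝ) (q : ℍ) :
    ∑ c, B (quatUnit c * q) (quatUnit c * q) = ‖q‖ ^ 2 * ∑ c, B (quatUnit c) (quatUnit c) := by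
  have h1 : ∀ p : ℍ, B p p = ∑ a, ∑ b, B (quatUnit a) (quatUnit b) *
      (inner ℝ (quatUnit a) p * inner ℝ (quatUnit b) p) := by
    intro p
    conv_lhs => rw [← sum_inner_quatUnit_smul p]
    simp only [map_sum, map_smul, _root_.sum_apply, _root_.smul_apply, smul_eq_mul, Finset.mul_sum]
    rw [Finset.sum_comm]
    refine Finset.sum_congr rfl fun a _ => Finset.sum_congr rfl fun b _ => ?_
    ring
  simp_rw [h1 (_ * q)]
  rw [Finset.sum_comm, Finset.mul_sum]
  refine Finset.sum_congr rfl fun a _ => ?_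
  rw [Finset.sum_comm]
  simp_rw [← Finset.mul_sum, sum_inner_quatUnit_mul]
  simp [mul_comm]

theorem setIntegral_closedBall_comp_isometry (e : ℍ ≃ₗᵢ[ℝ] ℍ) (g : ℍ → ℝ) (r : ℝ) :
    ∫ q in Metric.closedBall 0 r, g (e q) = ∫ q in Metric.closedBall 0 r, g q := by
  have := e.measurePreserving.setIntegral_preimage_emb e.toHomeomorph.measurableEmbedding g
    (Metric.closedBall 0 r)
  rw [← this]
  congr 2
  ext q
  simp

theorem setIntegral_closedBall_bilin (B : ℍ →L[ℝ] ℍ →L[ℝ] ℝ) (r : ℝ) :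
    4 * ∫ q in Metric.closedBall 0 r, B q q =
      (∑ c, B (quatUnit c) (quatUnit c)) * ∫ q in Metric.closedBall (0 : ℍ) r, ‖q‖ ^ 2 := by
  have hint : ∀ c : Fin 4, IntegrableOn (fun q => B (quatUnit c * q) (quatUnit c * q))
      (Metric.closedBall 0 r) := fun c =>
    ContinuousOn.integrableOn_compact (isCompact_closedBall 0 r)
      (Continuous.continuousOn (by fun_prop))
  have h1 : ∑ c : Fin 4, ∫ q in Metric.closedBall 0 r, B (quatUnit c * q) (quatUnit c * q) =
      ∑ c : Fin 4, ∫ q in Metric.closedBall 0 r, B q q :=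
    Finset.sum_congr rfl fun c _ =>
      setIntegral_closedBall_comp_isometry (quatUnitMulLeft c) (fun q => B q q) r
  rw [← integral_finsetSum _ fun c _ => hint c] at h1
  simp_rw [sum_bilin_quatUnit_mul] at h1
  rw [integral_mul_const] at h1
  simp only [Finset.sum_const, Finset.card_univ, Fintype.card_fin] at h1
  rw [mul_comm (∑ c, B (quatUnit c) (quatUnit c)), h1]
  simp

theorem setIntegral_closedBall_clm (l : ℍ →L[ℝ] ℝ) (r : ℝ) :
    ∫ q in Metric.closedBall 0 r, l q = 0 := by
  have := setIntegral_closedBall_comp_isometry (LinearIsometryEquiv.neg ℝ) l r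
  simp only [LinearIsometryEquiv.coe_neg, map_neg, integral_neg] at this
  linarith

theorem setIntegral_closedBall_norm_sq_pos {r : ℝ} (hr : 0 < r) :
    0 < ∫ q in Metric.closedBall (0 : ℍ) r, ‖q‖ ^ 2 := by
  have hc : Continuous fun q : ℍ => ‖q‖ ^ 2 := by fun_prop
  rw [setIntegral_pos_iff_support_of_nonneg_ae (.of_forall fun q => by positivity)
    (hc.continuousOn.integrableOn_compact (isCompact_closedBall 0 r))]
  have hU : IsOpen (Metric.ball (0 : ℍ) r \ {0}) := Metric.isOpen_ball.sdiff isClosed_singleton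
  have hne : (Metric.ball (0 : ℍ) r \ {0}).Nonempty := by
    refine ⟨((r / 2 : ℝ) : ℍ), ?_, ?_⟩
    · rw [mem_ball_zero_iff, Quaternion.norm_coe, Real.norm_eq_abs, abs_of_pos (by positivity)]
      linarith
    · rw [mem_singleton_iff, ← Quaternion.coe_zero, Quaternion.coe_inj]
      positivity
  refine (hU.measure_pos volume hne).trans_le (measure_mono ?_)
  rintro q ⟨hq, hq0⟩
  refine ⟨?_, Metric.ball_subset_closedBall hq⟩
  simpa using hq0

theorem exists_clm_mul_line {n : ℕ} (ξ : Fin n → ℍ) : ∃ l : ℍ →L[ℝ] QSpace n,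
    ∀ q, l q = fun i => ξ i * q :=
  ⟨ContinuousLinearMap.pi fun i => ContinuousLinearMap.mul ℝ ℍ (ξ i), fun q => by ext1 i; simp⟩

/-- The average of `f (z + ξ q) - f z` over a small ball `‖q‖ ≤ r` is, by Taylor's formula, a
positive multiple of `r²` times the Laplacian along the line, up to `o(r²)`. -/
theorem lineLaplacian_nonneg_of_le_setIntegral {n : ℕ} {f : QSpace n → ℝ} {z : QSpace n}
    (hf : ContDiffAt ℝ 2 f z) (ξ : Fin n → ℍ)
    (hint : ∀ᶠ r in 𝓝[>] (0 : ℝ),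
      IntegrableOn (fun q => f (z + fun i => ξ i * q)) (Metric.closedBall 0 r))
    (hsub : ∀ᶠ r in 𝓝[>] (0 : ℝ),
      0 ≤ ∫ q in Metric.closedBall (0 : ℍ) r, (f (z + fun i => ξ i * q) - f z)) :
    0 ≤ lineLaplacian ξ f z := by
  obtain ⟨l, hl⟩ := exists_clm_mul_line ξ
  simp_rw [← hl] at hint hsub
  let B : ℍ →L[ℝ] ℍ →L[ℝ] ℝ :=
    ((fderiv ℝ (fderiv ℝ f) z).comp l).flip.comp l
  have hB : ∀ p q, B p q = fderiv ℝ (fderiv ℝ f) z (l q) (l p) := fun p q => rfl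
  have hlap : lineLaplacian ξ f z = ∑ c, B (quatUnit c) (quatUnit c) := by
    simp only [lineLaplacian, hB, hl]
  rw [hlap]
  set t := ∑ c, B (quatUnit c) (quatUnit c) with ht
  have hO : (fun q => f (z + l q) - f z - fderiv ℝ f z (l q) - (1 / 2 : ℝ) * B q q)
      =o[𝓝 0] fun q : ℍ => ‖q‖ ^ 2 := by
    have hl0 : Tendsto l (𝓝 0) (𝓝 0) := by simpa using l.continuous.tendsto 0
    refine (hf.isLittleO_taylor_two.comp_tendsto hl0).trans_isBigO ?_
    exact Asymptotics.IsBigO.pow (l.isBigO_id (𝓝 0)).norm_norm 2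
  -- with the error `ε / 8 * ‖q‖²` in Taylor's formula, the sub-mean value inequality reads
  -- `0 ≤ (t + ε) / 8 * ∫ ‖q‖²`, because `∫ B q q = t / 4 * ∫ ‖q‖²`
  refine le_of_forall_pos_le_add fun ε hε => ?_
  have hev := Asymptotics.isLittleO_iff.1 hO (show (0 : ℝ) < ε / 8 by positivity)
  obtain ⟨δ, hδ, hball⟩ := Metric.eventually_nhds_iff_ball.1 hev
  obtain ⟨r, ⟨⟨hr1, hr2⟩, hrδ⟩, hr0⟩ := (((hint.and hsub).and
    (nhdsWithin_le_nhds (Iio_mem_nhds hδ))).and self_mem_nhdsWithin).exists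
  have hr0 : 0 < r := hr0
  have hK := isCompact_closedBall (0 : ℍ) r
  have hBi : IntegrableOn (fun q => B q q) (Metric.closedBall 0 r) :=
    ContinuousOn.integrableOn_compact hK (Continuous.continuousOn (by fun_prop))
  have hLi : IntegrableOn (fun q => (fderiv ℝ f z).comp l q) (Metric.closedBall 0 r) :=
    ContinuousOn.integrableOn_compact hK (Continuous.continuousOn (by fun_prop))
  have hNi : IntegrableOn (fun q : ℍ => ‖q‖ ^ 2) (Metric.closedBall 0 r) :=
    ContinuousOn.integrableOn_compact hK (Continuous.continuousOn (by fun_prop))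
  have hle : ∫ q in Metric.closedBall (0 : ℍ) r, (f (z + l q) - f z) ≤
      ∫ q in Metric.closedBall (0 : ℍ) r,
        ((fderiv ℝ f z).comp l q + ((1 / 2 : ℝ) * B q q + ε / 8 * ‖q‖ ^ 2)) := by
    refine setIntegral_mono_on
      (hr1.sub (integrableOn_const measure_closedBall_lt_top.ne))
      (hLi.add ((hBi.const_mul _).add (hNi.const_mul _)))
      Metric.isClosed_closedBall.measurableSet fun q hq => ?_
    have := hball q (Metric.closedBall_subset_ball hrδ hq)
    rw [Real.norm_eq_abs, Real.norm_eq_abs, abs_of_nonneg (by positivity : 0 ≤ ‖q‖ ^ 2)] at this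
    have h2 := (le_abs_self _).trans this
    change _ ≤ fderiv ℝ f z (l q) + _
    linarith
  have hsum := setIntegral_closedBall_bilin B r
  rw [← ht] at hsum
  rw [integral_add (g := fun q => (1 / 2 : ℝ) * B q q + ε / 8 * ‖q‖ ^ 2) hLi
      ((hBi.const_mul _).add (hNi.const_mul _)),
    integral_add (hBi.const_mul _) (hNi.const_mul _), setIntegral_closedBall_clm,
    integral_const_mul, integral_const_mul] at hle
  have hpos := setIntegral_closedBall_norm_sq_pos hr0
  by_contra hneg
  push Not at hneg
  have := mul_neg_of_neg_of_pos hneg hpos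
  nlinarith [hr2.trans hle]

end Laplacian

/-! ### Convolution with a smooth kernel -/

section Convolution

open scoped Convolution
open ContinuousLinearMap (lsmul)

variable {n : ℕ} {Ω : Set (QSpace n)} {u v χ : QSpace n → ℝ} {z : QSpace n}

theorem convolution_lsmul_comm (χ v : QSpace n → ℝ) :
    χ ⋆[lsmul ℝ ℝ, volume] v = v ⋆[lsmul ℝ ℝ, volume] χ := by
  rw [← convolution_flip]
  funext z
  simp [convolution_def, mul_comm]

theorem fderiv_convolution_apply (hχ : ContDiff ℝ 1 χ) (hc : HasCompactSupport χ)
    (hv : LocallyIntegrable v) (z b : QSpace n) :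
    DifferentiableAt ℝ (χ ⋆[lsmul ℝ ℝ, volume] v) z ∧
      fderiv ℝ (χ ⋆[lsmul ℝ ℝ, volume] v) z b =
        ((fun w => fderiv ℝ χ w b) ⋆[lsmul ℝ ℝ, volume] v) z := by
  have h := hc.hasFDerivAt_convolution_right (lsmul ℝ ℝ) hv hχ z
  rw [convolution_lsmul_comm χ v, convolution_lsmul_comm _ v]
  refine ⟨h.differentiableAt, ?_⟩
  rw [h.fderiv, convolution_precompR_apply _ hv (hc.fderiv ℝ) (hχ.continuous_fderiv one_ne_zero)]

theorem fderiv_fderiv_convolution_apply (hχ : ContDiff ℝ 2 χ) (hc : HasCompactSupport χ)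
    (hv : LocallyIntegrable v) (z a b : QSpace n) :
    fderiv ℝ (fderiv ℝ (χ ⋆[lsmul ℝ ℝ, volume] v)) z a b =
      ((fun w => fderiv ℝ (fderiv ℝ χ) w a b) ⋆[lsmul ℝ ℝ, volume] v) z := by
  have hsmooth : ContDiff ℝ 2 (χ ⋆[lsmul ℝ ℝ, volume] v) :=
    hc.contDiff_convolution_left (n := 2) (lsmul ℝ ℝ) hχ hv
  have happ : ∀ {f : QSpace n → ℝ}, ContDiff ℝ 2 f → ∀ w,
      fderiv ℝ (fderiv ℝ f) w a b = fderiv ℝ (fun w => fderiv ℝ f w b) w a := by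
    intro f hf w
    have hd : DifferentiableAt ℝ (fderiv ℝ f) w :=
      (hf.fderiv_right (m := 1) (by norm_num)).differentiable (by norm_num) w
    rw [fderiv_clm_apply hd (differentiableAt_const b)]
    simp
  rw [happ hsmooth]
  simp_rw [happ hχ]
  have h1 : (fun w => fderiv ℝ (χ ⋆[lsmul ℝ ℝ, volume] v) w b) =
      (fun w => fderiv ℝ χ w b) ⋆[lsmul ℝ ℝ, volume] v :=
    funext fun w => (fderiv_convolution_apply (hχ.of_le (by norm_num)) hc hv w b).2
  rw [h1]
  exact (fderiv_convolution_apply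
    ((hχ.fderiv_right (m := 1) (by norm_num)).clm_apply contDiff_const)
    (hc.fderiv_apply ℝ b) hv z a).2

theorem continuous_lineLaplacian (hχ : ContDiff ℝ 2 χ) (ξ : Fin n → ℍ) :
    Continuous (lineLaplacian ξ χ) := by
  have h : Continuous (fderiv ℝ (fderiv ℝ χ)) :=
    (hχ.fderiv_right (m := 1) (by norm_num)).continuous_fderiv (by norm_num)
  unfold lineLaplacian
  fun_prop

theorem lineLaplacian_eq_zero_of_notMem_tsupport (ξ : Fin n → ℍ) {w : QSpace n}
    (hw : w ∉ tsupport χ) : lineLaplacian ξ χ w = 0 := by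
  have h : fderiv ℝ (fderiv ℝ χ) w = 0 := image_eq_zero_of_notMem_tsupport fun h =>
    hw (tsupport_fderiv_subset ℝ (tsupport_fderiv_subset ℝ h))
  simp [lineLaplacian, h]

theorem lineLaplacian_congr {f g : QSpace n → ℝ} (h : f =ᶠ[𝓝 z] g) (ξ : Fin n → ℍ) :
    lineLaplacian ξ f z = lineLaplacian ξ g z := by
  simp only [lineLaplacian, h.fderiv.fderiv_eq]

theorem lineLaplacian_convolution (hχ : ContDiff ℝ 2 χ) (hc : HasCompactSupport χ)
    (hv : LocallyIntegrable v) (ξ : Fin n → ℍ) (z : QSpace n) :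
    lineLaplacian ξ (χ ⋆[lsmul ℝ ℝ, volume] v) z =
      (lineLaplacian ξ χ ⋆[lsmul ℝ ℝ, volume] v) z := by
  have hD : Continuous (fderiv ℝ (fderiv ℝ χ)) :=
    (hχ.fderiv_right (m := 1) (by norm_num)).continuous_fderiv (by norm_num)
  simp only [lineLaplacian, fderiv_fderiv_convolution_apply hχ hc hv, convolution_def]
  rw [← integral_finsetSum]
  · simp only [ContinuousLinearMap.lsmul_apply, smul_eq_mul, Finset.sum_mul]
  · intro c _
    refine HasCompactSupport.convolutionExists_left (lsmul ℝ ℝ) ?_ (by fun_prop) hv z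
    exact ((hc.fderiv ℝ).fderiv ℝ).mono fun w hw h => hw (by simp [h])

/-- Near a point `z` with `z - supp χ ⊆ Ω` the convolution with `χ` involves only the values of `u`
on some compact subset of `Ω`. -/
theorem exists_isCompact_convolution_eq (hΩ : IsOpen Ω) (hc : HasCompactSupport χ)
    (hz : ∀ w ∈ tsupport χ, z - w ∈ Ω) (u : QSpace n → ℝ) :
    ∃ K, IsCompact K ∧ K ⊆ Ω ∧ (∀ᶠ x in 𝓝 z, ∀ w ∈ tsupport χ, x - w ∈ K) ∧
      χ ⋆[lsmul ℝ ℝ, volume] u =ᶠ[𝓝 z] χ ⋆[lsmul ℝ ℝ, volume] (K.indicator u) := by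
  have hC : IsCompact ((fun w => z - w) '' tsupport χ) :=
    hc.isCompact.image (by fun_prop)
  obtain ⟨K, hK, hCK, hKΩ⟩ := exists_compact_between hC hΩ (by rintro _ ⟨w, hw, rfl⟩; exact hz w hw)
  have hev : ∀ᶠ x in 𝓝 z, ∀ w ∈ tsupport χ, x - w ∈ K := by
    refine hc.isCompact.eventually_forall_of_forall_eventually fun w hw => ?_
    have hcont : Continuous fun p : QSpace n × QSpace n => p.1 - p.2 := by fun_prop
    have hmem : interior K ∈ 𝓝 (z - w) := isOpen_interior.mem_nhds (hCK ⟨w, hw, rfl⟩)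
    filter_upwards [hcont.continuousAt.preimage_mem_nhds (x := (z, w)) hmem] with p hp
    exact interior_subset hp
  refine ⟨K, hK, hKΩ, hev, ?_⟩
  filter_upwards [hev] with x hx
  rw [convolution_def, convolution_def]
  congr 1 with w
  by_cases hw : w ∈ tsupport χ
  · rw [indicator_of_mem (hx w hw)]
  · simp [image_eq_zero_of_notMem_tsupport hw]

theorem integrable_indicator_of_isCompact (hu : LocallyIntegrableOn u Ω) {K : Set (QSpace n)}
    (hK : IsCompact K) (hKΩ : K ⊆ Ω) : Integrable (K.indicator u) :=
  (hu.integrableOn_compact_subset hKΩ hK).integrable_indicator hK.isClosed.measurableSet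

theorem contDiffAt_convolution (hΩ : IsOpen Ω) (hu : LocallyIntegrableOn u Ω)
    (hχ : ContDiff ℝ ∞ χ) (hc : HasCompactSupport χ) (hz : ∀ w ∈ tsupport χ, z - w ∈ Ω) :
    ContDiffAt ℝ ∞ (χ ⋆[lsmul ℝ ℝ, volume] u) z := by
  obtain ⟨K, hK, hKΩ, -, heq⟩ := exists_isCompact_convolution_eq hΩ hc hz u
  refine ContDiffAt.congr_of_eventuallyEq (ContDiff.contDiffAt ?_) heq
  exact hc.contDiff_convolution_left (lsmul ℝ ℝ) hχ
    (integrable_indicator_of_isCompact hu hK hKΩ).locallyIntegrable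

/-- The derivatives of a convolution fall on the kernel. -/
theorem lineLaplacian_convolution_of_mem (hΩ : IsOpen Ω) (hu : LocallyIntegrableOn u Ω)
    (hχ : ContDiff ℝ ∞ χ) (hc : HasCompactSupport χ) (hz : ∀ w ∈ tsupport χ, z - w ∈ Ω)
    (ξ : Fin n → ℍ) :
    lineLaplacian ξ (χ ⋆[lsmul ℝ ℝ, volume] u) z = ∫ w, u w * lineLaplacian ξ χ (z - w) := by
  obtain ⟨K, hK, hKΩ, hev, heq⟩ := exists_isCompact_convolution_eq hΩ hc hz u
  rw [lineLaplacian_congr heq, lineLaplacian_convolution (hχ.of_le (by norm_cast)) hc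
    (integrable_indicator_of_isCompact hu hK hKΩ).locallyIntegrable, convolution_lsmul_swap]
  congr 1 with w
  by_cases hw : z - w ∈ tsupport χ
  · have hwK : w ∈ K := by simpa using hev.self_of_nhds _ hw
    rw [indicator_of_mem hwK, smul_eq_mul, mul_comm]
  · simp [lineLaplacian_eq_zero_of_notMem_tsupport ξ hw]

theorem integral_norm_mul_sub_le (hχ : Continuous χ) (hc : HasCompactSupport χ)
    (hv : Integrable v) {C : ℝ} (hC : ∀ w, ‖χ w‖ ≤ C) (x : QSpace n) :
    ∫ w, ‖χ w * v (x - w)‖ ≤ C * ∫ w, ‖v w‖ := by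
  have h1 : ∫ w, ‖v w‖ = ∫ w, ‖v (x - w)‖ :=
    (integral_sub_left_eq_self (fun w => ‖v w‖) volume x).symm
  have hexists : Integrable fun w => χ w * v (x - w) :=
    HasCompactSupport.convolutionExists_left (lsmul ℝ ℝ) hc hχ hv.locallyIntegrable x
  rw [h1, ← integral_const_mul]
  refine integral_mono hexists.norm ((hv.comp_sub_left x).norm.const_mul C) fun w => ?_
  change ‖χ w * v (x - w)‖ ≤ C * ‖v (x - w)‖
  rw [norm_mul]
  exact mul_le_mul_of_nonneg_right (hC w) (norm_nonneg _)

theorem integrable_prod_mul_sub_line (hχ : Continuous χ) (hc : HasCompactSupport χ)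
    (hvm : Measurable v) (hv : Integrable v) (l : ℍ →L[ℝ] QSpace n) (z : QSpace n)
    (ν : Measure ℍ) [IsFiniteMeasure ν] :
    Integrable (fun p : ℍ × QSpace n => χ p.2 * v (z + l p.1 - p.2)) (ν.prod volume) := by
  obtain ⟨C, hC⟩ := hc.exists_bound_of_continuous hχ
  have hmeas : Measurable fun p : ℍ × QSpace n => χ p.2 * v (z + l p.1 - p.2) := by
    have h1 : Measurable fun p : ℍ × QSpace n => z + l p.1 - p.2 := by fun_prop
    have h2 : Measurable χ := hχ.measurable
    fun_prop
  have hsm := hmeas.aestronglyMeasurable (μ := ν.prod volume)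
  refine (integrable_prod_iff hsm).2 ⟨.of_forall fun q =>
    HasCompactSupport.convolutionExists_left (lsmul ℝ ℝ) hc hχ hv.locallyIntegrable (z + l q), ?_⟩
  refine Integrable.of_bound hsm.norm.integral_prod_right' (C * ∫ w, ‖v w‖)
    (.of_forall fun q => ?_)
  rw [Real.norm_eq_abs, abs_of_nonneg (integral_nonneg fun w => norm_nonneg _)]
  exact integral_norm_mul_sub_le hχ hc hv hC (z + l q)

/-- The mollification of a plurisubharmonic function satisfies the sub-mean value inequality on
small balls in quaternionic lines: it is a superposition of translates of the function. -/
theorem QuatPsh.lineLaplacian_convolution_nonneg (hΩ : IsOpen Ω) (hu : QuatPsh Ω u)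
    (hχ : ContDiff ℝ ∞ χ) (hc : HasCompactSupport χ) (hχ0 : ∀ w, 0 ≤ χ w)
    (hz : ∀ w ∈ tsupport χ, z - w ∈ Ω) (ξ : Fin n → ℍ) :
    0 ≤ lineLaplacian ξ (χ ⋆[lsmul ℝ ℝ, volume] u) z := by
  by_cases hξ : ξ = 0
  · have h0 : (fun _ : Fin n => (0 : ℍ)) = 0 := rfl
    simp [lineLaplacian, hξ, h0]
  obtain ⟨K, hK, hKΩ, hev, heq⟩ := exists_isCompact_convolution_eq hΩ hc hz u
  have hvi := integrable_indicator_of_isCompact (hu.locallyIntegrableOn hΩ) hK hKΩ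
  have hvm : Measurable (K.indicator u) :=
    hu.usc.measurable_indicator hK.isClosed.measurableSet hKΩ
  rw [lineLaplacian_congr heq]
  set v := K.indicator u
  have hsmooth : ContDiff ℝ ∞ (χ ⋆[lsmul ℝ ℝ, volume] v) :=
    hc.contDiff_convolution_left (lsmul ℝ ℝ) hχ hvi.locallyIntegrable
  have hcont := hsmooth.continuous
  have hexists : ∀ x, Integrable fun w => χ w * v (x - w) := fun x =>
    HasCompactSupport.convolutionExists_left (lsmul ℝ ℝ) hc hχ.continuous hvi.locallyIntegrable x
  obtain ⟨l, hl⟩ := exists_clm_mul_line ξ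
  have hcomp : ∀ r : ℝ, IntegrableOn
      (fun q => (χ ⋆[lsmul ℝ ℝ, volume] v) (z + fun i => ξ i * q)) (Metric.closedBall 0 r) := by
    intro r
    simp_rw [← hl]
    exact ContinuousOn.integrableOn_compact (isCompact_closedBall 0 r)
      (Continuous.continuousOn (by fun_prop))
  refine lineLaplacian_nonneg_of_le_setIntegral (hsmooth.of_le (by norm_cast)).contDiffAt ξ
    (.of_forall hcomp) ?_
  have hl0 : Tendsto (fun q => z + l q) (𝓝 0) (𝓝 z) := by
    have h : Continuous fun q => z + l q := by fun_prop
    simpa using h.tendsto 0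
  obtain ⟨δ, hδ, hball⟩ := Metric.eventually_nhds_iff_ball.1 (hl0.eventually hev)
  filter_upwards [nhdsWithin_le_nhds (Iio_mem_nhds hδ), self_mem_nhdsWithin] with r hrδ hr0
  have hr0 : 0 < r := hr0
  have hballK : ∀ q ∈ Metric.closedBall (0 : ℍ) r, ∀ w ∈ tsupport χ, z + l q - w ∈ K :=
    fun q hq => hball q (Metric.closedBall_subset_ball hrδ hq)
  have : IsFiniteMeasure (volume.restrict (Metric.closedBall (0 : ℍ) r)) :=
    isFiniteMeasure_restrict.2 measure_closedBall_lt_top.ne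
  have hfin : volume (Metric.closedBall (0 : ℍ) r) ≠ ⊤ := measure_closedBall_lt_top.ne
  have hVpos : 0 < volume.real (Metric.closedBall (0 : ℍ) r) :=
    ENNReal.toReal_pos (Metric.measure_closedBall_pos volume 0 hr0).ne' hfin
  have hprod := integrable_prod_mul_sub_line hχ.continuous hc hvm hvi l z
    (volume.restrict (Metric.closedBall 0 r))
  have hswap : ∫ q in Metric.closedBall (0 : ℍ) r, (χ ⋆[lsmul ℝ ℝ, volume] v) (z + l q) =
      ∫ w, χ w * ∫ q in Metric.closedBall (0 : ℍ) r, v (z + l q - w) := by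
    simp only [convolution_def, ContinuousLinearMap.lsmul_apply, smul_eq_mul]
    rw [integral_integral_swap hprod]
    simp_rw [integral_const_mul]
  have hle : volume.real (Metric.closedBall (0 : ℍ) r) * (χ ⋆[lsmul ℝ ℝ, volume] v) z ≤
      ∫ w, χ w * ∫ q in Metric.closedBall (0 : ℍ) r, v (z + l q - w) := by
    simp only [convolution_def, ContinuousLinearMap.lsmul_apply, smul_eq_mul]
    rw [← integral_const_mul]
    refine integral_mono ((hexists z).const_mul _) ?_ fun w => ?_
    · have := hprod.integral_prod_right
      simp_rw [integral_const_mul] at this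
      exact this
    · by_cases hw : w ∈ tsupport χ
      · have hline : ∀ q, (fun i => (z - w) i + ξ i * q) = z + l q - w := by
          intro q
          rw [hl]
          funext i
          exact sub_add_eq_add_sub (z i) (w i) (ξ i * q)
        have hsub := hu.subharmonic (z - w) ξ hξ
        simp only [hline] at hsub
        have havg := hsub.le_average 0 r hr0 fun q hq => hKΩ (hballK q hq w hw)
        rw [setAverage_eq, smul_eq_mul, inv_mul_eq_div, le_div_iff₀ hVpos] at havg
        have h1 : ∫ q in Metric.closedBall (0 : ℍ) r, v (z + l q - w) =
            ∫ q in Metric.closedBall (0 : ℍ) r, u (z + l q - w) :=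
          setIntegral_congr_fun Metric.isClosed_closedBall.measurableSet fun q hq =>
            indicator_of_mem (hballK q hq w hw) _
        have h2 : v (z - w) = u (z - w) := by
          refine indicator_of_mem ?_ _
          simpa using hballK 0 (Metric.mem_closedBall_self hr0.le) w hw
        simp only
        rw [h1, h2]
        simp only [map_zero, add_zero] at havg
        nlinarith [mul_le_mul_of_nonneg_left havg (hχ0 w)]
      · simp [image_eq_zero_of_notMem_tsupport hw]
  have hcr := hcomp r
  simp_rw [← hl] at hcr ⊢
  rw [integral_sub hcr (integrableOn_const hfin), hswap, setIntegral_const, smul_eq_mul]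
  linarith

end Convolution

/-! ### The distributional Laplacian along a line -/

section Distribution

open scoped Convolution
open ContinuousLinearMap (lsmul)

variable {n : ℕ} {Ω : Set (QSpace n)} {u χ φ : QSpace n → ℝ}

theorem lineLaplacian_comp_sub_left (hχ : ContDiff ℝ 2 χ) (ξ : Fin n → ℍ) (z w : QSpace n) :
    lineLaplacian ξ (fun w => χ (z - w)) w = lineLaplacian ξ χ (z - w) := by
  have hsub : ∀ w, HasFDerivAt (fun w : QSpace n => z - w)
      (-ContinuousLinearMap.id ℝ (QSpace n)) w := fun w => (hasFDerivAt_id w).const_sub z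
  have h1 : fderiv ℝ (fun w => χ (z - w)) = fun w => -fderiv ℝ χ (z - w) := by
    funext w
    have h : HasFDerivAt (fun w => χ (z - w)) _ w :=
      ((hχ.differentiable (by norm_num)) (z - w)).hasFDerivAt.comp w (hsub w)
    rw [h.fderiv]
    ext v
    simp
  have h2 : fderiv ℝ (fun w => -fderiv ℝ χ (z - w)) w = fderiv ℝ (fderiv ℝ χ) (z - w) := by
    have h : HasFDerivAt (fun w => fderiv ℝ χ (z - w)) _ w :=
      (((hχ.fderiv_right (m := 1) (by norm_num)).differentiable
        (by norm_num)) (z - w)).hasFDerivAt.comp w (hsub w)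
    rw [h.fun_neg.fderiv]
    ext v
    simp
  simp only [lineLaplacian, h1, h2]

theorem lineLaplacian_add {f g : QSpace n → ℝ} (hf : ContDiff ℝ 2 f) (hg : ContDiff ℝ 2 g)
    (ξ : Fin n → ℍ) (z : QSpace n) :
    lineLaplacian ξ (f + g) z = lineLaplacian ξ f z + lineLaplacian ξ g z := by
  have hd : ∀ {f : QSpace n → ℝ}, ContDiff ℝ 2 f → Differentiable ℝ f ∧
      Differentiable ℝ (fderiv ℝ f) := fun hf =>
    ⟨hf.differentiable (by norm_num),
      (hf.fderiv_right (m := 1) (by norm_num)).differentiable (by norm_num)⟩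
  have h1 : fderiv ℝ (f + g) = fderiv ℝ f + fderiv ℝ g :=
    funext fun w => fderiv_add ((hd hf).1 w) ((hd hg).1 w)
  have h2 : fderiv ℝ (fderiv ℝ f + fderiv ℝ g) z =
      fderiv ℝ (fderiv ℝ f) z + fderiv ℝ (fderiv ℝ g) z :=
    fderiv_add (𝕜 := ℝ) (E := QSpace n) (F := QSpace n →L[ℝ] ℝ) ((hd hf).2 z) ((hd hg).2 z)
  simp only [lineLaplacian, h1, h2, _root_.add_apply, Finset.sum_add_distrib]

theorem lineLaplacian_const_smul {f : QSpace n → ℝ} (hf : ContDiff ℝ 2 f) (c : ℝ)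
    (ξ : Fin n → ℍ) (z : QSpace n) :
    lineLaplacian ξ (c • f) z = c * lineLaplacian ξ f z := by
  have h1 : fderiv ℝ (c • f) = c • fderiv ℝ f :=
    funext fun w => fderiv_const_smul (hf.differentiable (by norm_num) w) c
  have h2 : DifferentiableAt ℝ (fderiv ℝ f) z :=
    (hf.fderiv_right (m := 1) (by norm_num)).differentiable (by norm_num) z
  have h3 : fderiv ℝ (c • fderiv ℝ f) z = c • fderiv ℝ (fderiv ℝ f) z :=
    fderiv_const_smul (𝕜 := ℝ) (E := QSpace n) (F := QSpace n →L[ℝ] ℝ) h2 c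
  simp only [lineLaplacian, h1, h3, _root_.smul_apply, smul_eq_mul, Finset.mul_sum]

theorem integrable_mul_of_locallyIntegrableOn (hu : LocallyIntegrableOn u Ω) {g : QSpace n → ℝ}
    (hg : Continuous g) {K : Set (QSpace n)} (hK : IsCompact K) (hKΩ : K ⊆ Ω)
    (hgK : ∀ x ∉ K, g x = 0) : Integrable fun x => u x * g x := by
  have h1 : IntegrableOn (fun x => u x * g x) K :=
    (hu.integrableOn_compact_subset hKΩ hK).mul_continuousOn hg.continuousOn hK
  rwa [integrableOn_iff_integrable_of_support_subset] at h1
  intro x hx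
  by_contra hxK
  exact hx (by simp [hgK x hxK])

theorem integrable_mul_lineLaplacian (hu : LocallyIntegrableOn u Ω) (hφ : IsTestFunction Ω φ)
    (ξ : Fin n → ℍ) : Integrable fun w => u w * lineLaplacian ξ φ w :=
  integrable_mul_of_locallyIntegrableOn hu
    (continuous_lineLaplacian (hφ.contDiff.of_le (by norm_cast)) ξ) hφ.hasCompactSupport.isCompact
    hφ.tsupport_subset fun _ hx => lineLaplacian_eq_zero_of_notMem_tsupport ξ hx

theorem tsupport_comp_sub_left (χ : QSpace n → ℝ) (z : QSpace n) :
    tsupport (fun w => χ (z - w)) = (fun w => z - w) ⁻¹' tsupport χ :=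
  tsupport_comp_eq_preimage χ (Homeomorph.subLeft z)

theorem isTestFunction_comp_sub_left {z : QSpace n} (hχ : ContDiff ℝ ∞ χ)
    (hc : HasCompactSupport χ) (hz : ∀ w ∈ tsupport χ, z - w ∈ Ω) :
    IsTestFunction Ω fun w => χ (z - w) := by
  refine ⟨hχ.comp (contDiff_const.sub contDiff_id),
    hc.comp_homeomorph (Homeomorph.subLeft z), ?_⟩
  rw [tsupport_comp_sub_left]
  intro w hw
  simpa using hz _ hw

/-- The value of the distributional Laplacian of `u` at a reflected translate of a kernel `χ` is the
Laplacian of the convolution of `u` with `χ`. -/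
theorem integral_mul_lineLaplacian_comp_sub_left (hΩ : IsOpen Ω) (hu : LocallyIntegrableOn u Ω)
    {z : QSpace n} (hχ : ContDiff ℝ ∞ χ) (hc : HasCompactSupport χ)
    (hz : ∀ w ∈ tsupport χ, z - w ∈ Ω) (ξ : Fin n → ℍ) :
    ∫ w, u w * lineLaplacian ξ (fun w => χ (z - w)) w =
      lineLaplacian ξ (χ ⋆[lsmul ℝ ℝ, volume] u) z := by
  rw [lineLaplacian_convolution_of_mem hΩ hu hχ hc hz]
  simp_rw [lineLaplacian_comp_sub_left (hχ.of_le (by norm_cast))]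

/-- The distributional Laplacian of `u` at a test function `φ` is the Laplacian at `0` of the
convolution of `u` with the reflection of `φ`. -/
theorem integral_mul_lineLaplacian_eq (hΩ : IsOpen Ω) (hu : LocallyIntegrableOn u Ω)
    (hφ : IsTestFunction Ω φ) (ξ : Fin n → ℍ) :
    ∫ w, u w * lineLaplacian ξ φ w =
      lineLaplacian ξ ((fun w => φ (0 - w)) ⋆[lsmul ℝ ℝ, volume] u) 0 := by
  rw [← integral_mul_lineLaplacian_comp_sub_left hΩ hu (χ := fun w => φ (0 - w))]
  · simp
  · exact hφ.contDiff.comp (contDiff_const.sub contDiff_id)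
  · exact hφ.hasCompactSupport.comp_homeomorph (Homeomorph.subLeft 0)
  · rw [tsupport_comp_sub_left]
    exact fun w hw => hφ.tsupport_subset hw

theorem contDiffAt_convolution_comp_neg (hΩ : IsOpen Ω) (hu : LocallyIntegrableOn u Ω)
    (hφ : IsTestFunction Ω φ) :
    ContDiffAt ℝ ∞ ((fun w => φ (0 - w)) ⋆[lsmul ℝ ℝ, volume] u) 0 := by
  refine contDiffAt_convolution hΩ hu (hφ.contDiff.comp (contDiff_const.sub contDiff_id))
    (hφ.hasCompactSupport.comp_homeomorph (Homeomorph.subLeft 0)) ?_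
  rw [tsupport_comp_sub_left]
  exact fun w hw => hφ.tsupport_subset hw

theorem QuatPsh.integral_mul_lineLaplacian_nonneg (hΩ : IsOpen Ω) (hu : QuatPsh Ω u)
    (hφ : IsTestFunction Ω φ) (hφ0 : ∀ x, 0 ≤ φ x) (ξ : Fin n → ℍ) :
    0 ≤ ∫ w, u w * lineLaplacian ξ φ w := by
  rw [integral_mul_lineLaplacian_eq hΩ (hu.locallyIntegrableOn hΩ) hφ]
  refine hu.lineLaplacian_convolution_nonneg hΩ (χ := fun w => φ (0 - w))
    (hφ.contDiff.comp (contDiff_const.sub contDiff_id))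
    (hφ.hasCompactSupport.comp_homeomorph (Homeomorph.subLeft 0)) (fun w => hφ0 _) ?_ ξ
  rw [tsupport_comp_sub_left]
  exact fun w hw => hφ.tsupport_subset hw

/-- A family of measures `m ξ` that represent the distributional Laplacians of `u` along the right
quaternionic lines in the directions `ξ`. -/
structure IsLaplacianFamily (Ω : Set (QSpace n)) (u : QSpace n → ℝ)
    (m : (Fin n → ℍ) → Measure (QSpace n)) : Prop where
  lt_top : ∀ ξ K, IsCompact K → K ⊆ Ω → m ξ K < ⊤
  integral_eq : ∀ ξ φ, IsTestFunction Ω φ → ∫ x, φ x ∂(m ξ) = ∫ w, u w * lineLaplacian ξ φ w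

theorem QuatPsh.exists_isLaplacianFamily (hΩ : IsOpen Ω) (hu : QuatPsh Ω u) :
    ∃ m, IsLaplacianFamily Ω u m := by
  have hli := hu.locallyIntegrableOn hΩ
  have h2 : ∀ {φ}, IsTestFunction Ω φ → ContDiff ℝ 2 φ := fun hφ => hφ.contDiff.of_le (by norm_cast)
  have h := fun ξ => exists_measure_eq_of_nonneg hΩ (fun φ => ∫ w, u w * lineLaplacian ξ φ w)
    (fun φ ψ hφ hψ => by
      rw [← integral_add (integrable_mul_lineLaplacian hli hφ ξ)
        (integrable_mul_lineLaplacian hli hψ ξ)]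
      simp_rw [lineLaplacian_add (h2 hφ) (h2 hψ), mul_add])
    (fun c φ hφ => by
      rw [← integral_const_mul]
      simp_rw [lineLaplacian_const_smul (h2 hφ), mul_left_comm])
    (fun φ hφ hφ0 => hu.integral_mul_lineLaplacian_nonneg hΩ hφ hφ0 ξ)
  choose m hm1 hm2 using h
  exact ⟨m, hm1, hm2⟩

/-- For a `C²` function the distributional Laplacian is the pointwise one. -/
theorem integral_mul_lineLaplacian_comm (hΩ : IsOpen Ω) (hu : ContDiffOn ℝ 2 u Ω)
    (hφ : IsTestFunction Ω φ) (ξ : Fin n → ℍ) :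
    ∫ w, u w * lineLaplacian ξ φ w = ∫ w, φ w * lineLaplacian ξ u w := by
  obtain ⟨ψ, hψ, -, hψ1⟩ := exists_isTestFunction_one_nhdsSet hΩ hφ.hasCompactSupport.isCompact
    hφ.tsupport_subset
  have hv2 : ContDiff ℝ 2 (fun x => ψ x * u x) := by
    rw [contDiff_iff_contDiffAt]
    intro x
    by_cases hx : x ∈ tsupport ψ
    · exact (hψ.contDiff.of_le (by norm_cast)).contDiffAt.mul
        (hu.contDiffAt (hΩ.mem_nhds (hψ.tsupport_subset hx)))
    · refine (contDiffAt_const (c := (0 : ℝ))).congr_of_eventuallyEq ?_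
      filter_upwards [(isClosed_tsupport ψ).isOpen_compl.mem_nhds hx] with y hy
      simp [image_eq_zero_of_notMem_tsupport hy]
  have hvc : HasCompactSupport (fun x => ψ x * u x) := hψ.hasCompactSupport.mul_right
  have heq : ∀ x ∈ tsupport φ, (fun x => ψ x * u x) =ᶠ[𝓝 x] u := by
    intro x hx
    filter_upwards [hψ1.filter_mono (nhds_le_nhdsSet hx)] with y hy
    simp [hy]
  set v := fun x => ψ x * u x
  have h1 : ∫ w, u w * lineLaplacian ξ φ w = ∫ w, v w * lineLaplacian ξ φ w := by
    congr 1 with w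
    by_cases hw : w ∈ tsupport φ
    · rw [(heq w hw).self_of_nhds]
    · simp [lineLaplacian_eq_zero_of_notMem_tsupport ξ hw]
  have h2 : ∫ w, φ w * lineLaplacian ξ u w = ∫ w, φ w * lineLaplacian ξ v w := by
    congr 1 with w
    by_cases hw : w ∈ tsupport φ
    · rw [lineLaplacian_congr (heq w hw)]
    · simp [image_eq_zero_of_notMem_tsupport hw]
  -- both sides are the Laplacian at `0` of the convolution of `v` with the reflection of `φ`
  have hχ : ContDiff ℝ 2 (fun w => φ (0 - w)) :=
    (hφ.contDiff.of_le (by norm_cast)).comp (contDiff_const.sub contDiff_id)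
  have hχc : HasCompactSupport (fun w => φ (0 - w)) :=
    hφ.hasCompactSupport.comp_homeomorph (Homeomorph.subLeft 0)
  have h3 := lineLaplacian_convolution hχ hχc
    (hv2.continuous.integrable_of_hasCompactSupport hvc).locallyIntegrable ξ 0
  have h4 := lineLaplacian_convolution hv2 hvc
    (hχ.continuous.integrable_of_hasCompactSupport hχc).locallyIntegrable ξ 0
  rw [convolution_lsmul_comm, h4, convolution_lsmul_swap, convolution_lsmul] at h3
  rw [h1, h2]
  have e1 : ∫ w, v w * lineLaplacian ξ φ w = ∫ t, v (0 - t) * lineLaplacian ξ φ (0 - t) :=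
    (integral_sub_left_eq_self (fun w => v w * lineLaplacian ξ φ w) volume 0).symm
  have e2 : ∫ w, φ w * lineLaplacian ξ v w = ∫ t, φ (0 - t) * lineLaplacian ξ v (0 - t) :=
    (integral_sub_left_eq_self (fun w => φ w * lineLaplacian ξ v w) volume 0).symm
  rw [e1, e2]
  simp only [smul_eq_mul, lineLaplacian_comp_sub_left (hφ.contDiff.of_le (by norm_cast))] at h3
  simp_rw [mul_comm (v _), ← h3, mul_comm (lineLaplacian ξ v _)]

end Distribution

/-! ### Weak convergence of the mollified Laplacians -/

section WeakConvergence

open scoped Convolution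
open ContinuousLinearMap (lsmul)

variable {n : ℕ} {Ω : Set (QSpace n)} {u χ φ : QSpace n → ℝ} {ε : ℝ}

theorem contDiff_scaledKernel (hχ : ContDiff ℝ ∞ χ) : ContDiff ℝ ∞ (scaledKernel χ ε) :=
  contDiff_const.mul (hχ.comp (contDiff_id.const_smul ε⁻¹))

theorem hasCompactSupport_scaledKernel (hχ : HasCompactSupport χ) (hε : 0 < ε) :
    HasCompactSupport (scaledKernel χ ε) :=
  (hχ.comp_homeomorph (Homeomorph.smulOfNeZero ε⁻¹ (inv_ne_zero hε.ne'))).mul_left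

theorem exists_smul_eq_of_mem_tsupport_scaledKernel (hε : 0 < ε) {w : QSpace n}
    (hw : w ∈ tsupport (scaledKernel χ ε)) : ∃ y ∈ tsupport χ, w = ε • y := by
  have h1 : w ∈ tsupport fun z => χ (ε⁻¹ • z) :=
    tsupport_mul_subset_right (f := fun _ => (ε ^ (4 * n))⁻¹) hw
  have h2 : tsupport (fun z => χ (ε⁻¹ • z)) = (fun z => ε⁻¹ • z) ⁻¹' tsupport χ :=
    tsupport_comp_eq_preimage χ (Homeomorph.smulOfNeZero ε⁻¹ (inv_ne_zero hε.ne'))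
  rw [h2] at h1
  exact ⟨ε⁻¹ • w, h1, by rw [smul_inv_smul₀ hε.ne']⟩

theorem sub_mem_of_mem_mollifyDomain (hε : 0 < ε) {z : QSpace n} (hz : z ∈ mollifyDomain χ Ω ε) :
    ∀ w ∈ tsupport (scaledKernel χ ε), z - w ∈ Ω := by
  intro w hw
  obtain ⟨y, hy, rfl⟩ := exists_smul_eq_of_mem_tsupport_scaledKernel hε hw
  exact hz y hy

theorem contDiffAt_mollify (hΩ : IsOpen Ω) (hu : LocallyIntegrableOn u Ω) (hχ : SmoothingKernel χ)
    (hε : 0 < ε) {z : QSpace n} (hz : z ∈ mollifyDomain χ Ω ε) :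
    ContDiffAt ℝ ∞ (mollify χ u ε) z :=
  contDiffAt_convolution hΩ hu (contDiff_scaledKernel hχ.smooth)
    (hasCompactSupport_scaledKernel hχ.compactSupport hε) (sub_mem_of_mem_mollifyDomain hε hz)

theorem finrank_qSpace : Module.finrank ℝ (QSpace n) = 4 * n := by
  rw [Module.finrank_pi_fintype]
  simp [Quaternion.finrank_eq_four, mul_comm]

theorem integral_mul_scaledKernel (hε : 0 < ε) (φ χ : QSpace n → ℝ) (w : QSpace n) :
    ∫ z, φ z * scaledKernel χ ε (z - w) = ∫ y, φ (w + ε • y) * χ y := by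
  rw [← integral_add_left_eq_self _ w]
  have h := Measure.integral_comp_smul (volume : Measure (QSpace n))
    (fun y => φ (w + ε • y) * χ y) ε⁻¹
  have hp : |((ε⁻¹ : ℝ) ^ (4 * n))⁻¹| = ε ^ (4 * n) := by
    rw [inv_pow, inv_inv, abs_of_pos (by positivity)]
  rw [finrank_qSpace, hp, smul_eq_mul] at h
  have h2 : ∀ z, φ (w + z) * scaledKernel χ ε (w + z - w) =
      (ε ^ (4 * n))⁻¹ * (φ (w + ε • ε⁻¹ • z) * χ (ε⁻¹ • z)) := by
    intro z
    rw [smul_inv_smul₀ hε.ne', add_sub_cancel_left, scaledKernel]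
    ring
  simp_rw [h2]
  rw [integral_const_mul, h, inv_mul_cancel_left₀ (by positivity)]

/-- For small `ε` the points `z - ε w`, with `z` in the support of a test function and `w` in the
support of the kernel, stay in a fixed compact subset of `Ω`. -/
theorem exists_isCompact_eventually_sub_smul_mem (hΩ : IsOpen Ω) (hχ : HasCompactSupport χ)
    (hφ : HasCompactSupport φ) (hφΩ : tsupport φ ⊆ Ω) :
    ∃ K, IsCompact K ∧ K ⊆ Ω ∧ tsupport φ ⊆ K ∧
      ∀ᶠ ε in 𝓝 (0 : ℝ), ∀ z ∈ tsupport φ, ∀ w ∈ tsupport χ, z - ε • w ∈ K := by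
  obtain ⟨K, hK, hφK, hKΩ⟩ := exists_compact_between hφ.isCompact hΩ hφΩ
  refine ⟨K, hK, hKΩ, hφK.trans interior_subset, ?_⟩
  have hev : ∀ᶠ ε in 𝓝 (0 : ℝ), ∀ p ∈ tsupport φ ×ˢ tsupport χ, p.1 - ε • p.2 ∈ K := by
    refine (hφ.isCompact.prod hχ.isCompact).eventually_forall_of_forall_eventually
      fun p hp => ?_
    have hcont : Continuous fun t : ℝ × QSpace n × QSpace n => t.2.1 - t.1 • t.2.2 := by fun_prop
    have hmem : interior K ∈ 𝓝 (p.1 - (0 : ℝ) • p.2) := by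
      rw [zero_smul, sub_zero]
      exact isOpen_interior.mem_nhds (hφK hp.1)
    filter_upwards [hcont.continuousAt.preimage_mem_nhds (x := ((0 : ℝ), p)) hmem] with t ht
    exact interior_subset ht
  filter_upwards [hev] with ε hε z hz w hw
  exact hε (z, w) ⟨hz, hw⟩

theorem integrable_prod_mul_sub {κ : QSpace n → ℝ} (hφ : Continuous φ) (hφc : HasCompactSupport φ)
    (hκ : Continuous κ) (hκc : HasCompactSupport κ) (ν : Measure (QSpace n)) [IsFiniteMeasure ν] :
    Integrable (fun p : QSpace n × QSpace n => φ p.1 * κ (p.1 - p.2)) (volume.prod ν) := by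
  obtain ⟨C, hC⟩ := hκc.exists_bound_of_continuous hκ
  have h1 : Integrable (fun p : QSpace n × QSpace n => φ p.1) (volume.prod ν) :=
    (hφ.integrable_of_hasCompactSupport hφc).comp_fst ν
  have h2 : Continuous fun p : QSpace n × QSpace n => κ (p.1 - p.2) := by fun_prop
  exact h1.mul_bdd (c := C) h2.aestronglyMeasurable (.of_forall fun p => hC _)

variable {m : (Fin n → ℍ) → Measure (QSpace n)}

/-- The Laplacians of the mollifications are the mollifications of the representing measures. -/
theorem IsLaplacianFamily.lineLaplacian_mollify (hm : IsLaplacianFamily Ω u m) (hΩ : IsOpen Ω)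
    (hu : LocallyIntegrableOn u Ω) (hχ : SmoothingKernel χ) (hε : 0 < ε) {z : QSpace n}
    (hz : z ∈ mollifyDomain χ Ω ε) (ξ : Fin n → ℍ) :
    lineLaplacian ξ (mollify χ u ε) z = ∫ w, scaledKernel χ ε (z - w) ∂(m ξ) := by
  have hs := contDiff_scaledKernel (ε := ε) hχ.smooth
  have hc := hasCompactSupport_scaledKernel hχ.compactSupport hε
  have hz' := sub_mem_of_mem_mollifyDomain hε hz
  rw [hm.integral_eq ξ _ (isTestFunction_comp_sub_left hs hc hz')]
  exact (integral_mul_lineLaplacian_comp_sub_left hΩ hu hs hc hz' ξ).symm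

theorem SmoothingKernel.integrable (hχ : SmoothingKernel χ) : Integrable χ :=
  hχ.smooth.continuous.integrable_of_hasCompactSupport hχ.compactSupport

/-- After Fubini's theorem the kernel acts on the test function, where it is an approximation of the
identity. -/
theorem IsLaplacianFamily.tendsto_integral_mollify (hm : IsLaplacianFamily Ω u m) (hΩ : IsOpen Ω)
    (hu : LocallyIntegrableOn u Ω) (hχ : SmoothingKernel χ) (hφ : Continuous φ)
    (hφc : HasCompactSupport φ) (hφΩ : tsupport φ ⊆ Ω) (ξ : Fin n → ℍ) :
    Tendsto (fun ε => ∫ z, φ z * lineLaplacian ξ (mollify χ u ε) z) (𝓝[>] 0)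
      (𝓝 (∫ z, φ z ∂(m ξ))) := by
  obtain ⟨K, hK, hKΩ, hφK, hev⟩ :=
    exists_isCompact_eventually_sub_smul_mem hΩ hχ.compactSupport hφc hφΩ
  set ν := (m ξ).restrict K with hν
  have : IsFiniteMeasure ν := isFiniteMeasure_restrict.2 (hm.lt_top ξ K hK hKΩ).ne
  have hev' : ∀ᶠ ε in 𝓝[>] (0 : ℝ),
      0 < ε ∧ ∀ z ∈ tsupport φ, ∀ w ∈ tsupport χ, z - ε • w ∈ K :=
    (eventually_mem_nhdsWithin).and (nhdsWithin_le_nhds hev)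
  have hprod : ∀ ε : ℝ, 0 < ε → Integrable
      (fun p : QSpace n × QSpace n => φ p.1 * scaledKernel χ ε (p.1 - p.2)) (volume.prod ν) :=
    fun ε hε => integrable_prod_mul_sub hφ hφc (contDiff_scaledKernel hχ.smooth).continuous
      (hasCompactSupport_scaledKernel hχ.compactSupport hε) ν
  have heq : ∀ᶠ ε in 𝓝[>] (0 : ℝ), ∫ w, ∫ z, φ z * scaledKernel χ ε (z - w) ∂volume ∂ν =
      ∫ z, φ z * lineLaplacian ξ (mollify χ u ε) z := by
    filter_upwards [hev'] with ε ⟨hε, hεK⟩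
    rw [← integral_integral_swap (hprod ε hε)]
    congr 1 with z
    by_cases hz : z ∈ tsupport φ
    · rw [integral_const_mul, hm.lineLaplacian_mollify hΩ hu hχ hε
        (fun w hw => hKΩ (hεK z hz w hw)) ξ]
      congr 1
      refine setIntegral_eq_integral_of_forall_compl_eq_zero fun w hw => ?_
      by_contra hne
      obtain ⟨y, hy, hzw⟩ := exists_smul_eq_of_mem_tsupport_scaledKernel hε
        (subset_tsupport _ (Function.mem_support.2 hne))
      refine hw ?_
      have := hεK z hz y hy
      rwa [← hzw, sub_sub_cancel] at this
    · simp [image_eq_zero_of_notMem_tsupport hz]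
  refine Tendsto.congr' heq ?_
  have hlimit : ∫ z, φ z ∂(m ξ) = ∫ z, φ z ∂ν :=
    (setIntegral_eq_integral_of_forall_compl_eq_zero fun z hz =>
      image_eq_zero_of_notMem_tsupport fun h => hz (hφK h)).symm
  rw [hlimit]
  obtain ⟨C, hC⟩ := hφc.exists_bound_of_continuous hφ
  have hbound : ∀ (ε : ℝ) (w y : QSpace n), ‖φ (w + ε • y) * χ y‖ ≤ C * χ y := by
    intro ε w y
    rw [norm_mul, Real.norm_eq_abs (χ y), abs_of_nonneg (hχ.nonneg y)]
    exact mul_le_mul_of_nonneg_right (hC _) (hχ.nonneg y)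
  refine tendsto_integral_filter_of_dominated_convergence (fun _ => C) ?_ ?_
    (integrable_const C) (.of_forall fun w => ?_)
  · filter_upwards [hev'] with ε ⟨hε, _⟩
    exact (hprod ε hε).integral_prod_right.aestronglyMeasurable
  · filter_upwards [hev'] with ε ⟨hε, _⟩
    refine .of_forall fun w => ?_
    rw [integral_mul_scaledKernel hε]
    refine (norm_integral_le_of_norm_le (hχ.integrable.const_mul C)
      (.of_forall (hbound ε w))).trans_eq ?_
    rw [integral_const_mul, hχ.integral_eq_one, mul_one]
  · have h1 : Tendsto (fun ε : ℝ => ∫ y, φ (w + ε • y) * χ y) (𝓝[>] 0)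
        (𝓝 (∫ y, φ w * χ y)) := by
      refine tendsto_integral_filter_of_dominated_convergence (fun y => C * χ y)
        (.of_forall fun ε => ?_) (.of_forall fun ε => .of_forall (hbound ε w))
        (hχ.integrable.const_mul C) (.of_forall fun y => ?_)
      · have hχc := hχ.smooth.continuous
        exact Continuous.aestronglyMeasurable (by fun_prop)
      · have hc : Continuous fun ε : ℝ => φ (w + ε • y) * χ y := by fun_prop
        have := hc.tendsto 0
        simp only [zero_smul, add_zero] at this
        exact this.mono_left nhdsWithin_le_nhds
    rw [integral_const_mul, hχ.integral_eq_one, mul_one] at h1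
    refine h1.congr' ?_
    filter_upwards [hev'] with ε ⟨hε, _⟩
    exact (integral_mul_scaledKernel hε φ χ w).symm

end WeakConvergence

/-! ### The measure of second derivatives -/

section Construction

open scoped Convolution
open ContinuousLinearMap (lsmul)

variable {n : ℕ} {Ω : Set (QSpace n)} {u χ φ : QSpace n → ℝ}
  {m : (Fin n → ℍ) → Measure (QSpace n)}

theorem quatForm_add_matrix (A B : Matrix (Fin n) (Fin n) ℍ) (ξ : Fin n → ℍ) :
    quatForm (A + B) ξ = quatForm A ξ + quatForm B ξ := by
  simp only [quatForm, ← Quaternion.re_add, ← Finset.sum_add_distrib, Matrix.add_apply, mul_add,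
    add_mul]

theorem continuous_quatForm : Continuous (quatForm (n := n)) := by
  refine continuous_pi fun ξ => Quaternion.continuous_re.comp ?_
  refine continuous_finsetSum _ fun i _ => continuous_finsetSum _ fun j _ => ?_
  exact (continuous_const.mul (continuous_id.matrix_elem i j)).mul continuous_const

theorem quatNonneg_iff {A : Matrix (Fin n) (Fin n) ℍ} :
    QuatNonneg A ↔ A.IsHermitian ∧ ∀ ξ, 0 ≤ quatForm A ξ := Iff.rfl

namespace IsLaplacianFamily

theorem measure_lt_top (hm : IsLaplacianFamily Ω u m) {A : Set (QSpace n)}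
    (hA : RelCompactBorel Ω A) (ξ : Fin n → ℍ) : m ξ A < ⊤ := by
  obtain ⟨-, K, hK, hKΩ, hAK⟩ := hA
  exact (measure_mono hAK).trans_lt (hm.lt_top ξ K hK hKΩ)

theorem hasSum_real (hm : IsLaplacianFamily Ω u m) {A : ℕ → Set (QSpace n)}
    (hA : ∀ k, MeasurableSet (A k)) (hd : Pairwise (fun k l => Disjoint (A k) (A l)))
    (hU : RelCompactBorel Ω (⋃ k, A k)) :
    HasSum (fun k ξ => (m ξ).real (A k)) (fun ξ => (m ξ).real (⋃ k, A k)) := by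
  refine Pi.hasSum.2 fun ξ => ?_
  have h := measure_iUnion (μ := m ξ) hd hA
  have hne : ∑' k, m ξ (A k) ≠ ⊤ := h ▸ (hm.measure_lt_top hU ξ).ne
  simp only [Measure.real]
  rw [h, ENNReal.tsum_toReal_eq fun k => ENNReal.ne_top_of_tsum_ne_top hne k]
  exact (ENNReal.summable_toReal hne).hasSum

theorem tendsto_integral_indicator (hm : IsLaplacianFamily Ω u m) {K L : Set (QSpace n)}
    (hK : IsCompact K) (hL : IsCompact L) (hLΩ : L ⊆ Ω) {φ : ℕ → QSpace n → ℝ}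
    (hφ : ∀ k, IsTestFunction Ω (φ k)) (hφL : ∀ k, tsupport (φ k) ⊆ L)
    (h01 : ∀ k x, φ k x ∈ Icc (0 : ℝ) 1)
    (hlim : ∀ x, Tendsto (fun k => φ k x) atTop (𝓝 (K.indicator 1 x))) (ξ : Fin n → ℍ) :
    Tendsto (fun k => ∫ x, φ k x ∂(m ξ)) atTop (𝓝 ((m ξ).real K)) := by
  rw [← integral_indicator_one hK.isClosed.measurableSet]
  refine tendsto_integral_of_dominated_convergence (L.indicator 1)
    (fun k => (hφ k).contDiff.continuous.aestronglyMeasurable) ?_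
    (fun k => .of_forall fun x => ?_) (.of_forall hlim)
  · rw [integrable_indicator_iff hL.isClosed.measurableSet]
    exact integrableOn_const (hm.lt_top ξ L hL hLΩ).ne
  · rw [Real.norm_eq_abs, abs_of_nonneg (h01 k x).1]
    by_cases hx : x ∈ L
    · rw [indicator_of_mem hx]
      exact (h01 k x).2
    · rw [image_eq_zero_of_notMem_tsupport fun h => hx (hφL k h), indicator_of_notMem hx]

/-- A continuous linear relation between the integrals of test functions with respect to the
measures `m ξ` holds for their values at relatively compact Borel sets. -/
theorem map_real_eq_zero (hm : IsLaplacianFamily Ω u m) (hΩ : IsOpen Ω) {V : Type*}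
    [AddCommGroup V] [TopologicalSpace V] [T2Space V] (Φ : ((Fin n → ℍ) → ℝ) →+ V)
    (hΦ : Continuous Φ) (h : ∀ φ, IsTestFunction Ω φ → Φ (fun ξ => ∫ x, φ x ∂(m ξ)) = 0)
    {A : Set (QSpace n)} (hA : RelCompactBorel Ω A) : Φ (fun ξ => (m ξ).real A) = 0 := by
  refine hA.eq_zero_of_forall_isCompact (Ω := Ω) (fun A => Φ fun ξ => (m ξ).real A)
    (fun B hB hd hU => (hm.hasSum_real hB hd hU).map Φ hΦ) fun K hK hKΩ => ?_
  obtain ⟨L, φ, hL, hLΩ, -, hφ, hφL, h01, hlim⟩ :=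
    exists_seq_isTestFunction_tendsto_indicator hΩ hK hKΩ
  have h1 : Tendsto (fun k ξ => ∫ x, φ k x ∂(m ξ)) atTop (𝓝 fun ξ => (m ξ).real K) :=
    tendsto_pi_nhds.2 fun ξ => hm.tendsto_integral_indicator hK hL hLΩ hφ hφL h01 hlim ξ
  refine tendsto_nhds_unique ((hΦ.tendsto _).comp h1) (tendsto_const_nhds.congr fun k => ?_)
  exact (h (φ k) (hφ k)).symm

/-- The integrals of a test function with respect to the measures `m ξ` are the values of a
hyperhermitian form. -/
theorem integral_eq_quatForm (hm : IsLaplacianFamily Ω u m) (hΩ : IsOpen Ω)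
    (hu : LocallyIntegrableOn u Ω) (hφ : IsTestFunction Ω φ) :
    ∃ H : Matrix (Fin n) (Fin n) ℍ, H.IsHermitian ∧
      (fun ξ => ∫ x, φ x ∂(m ξ)) = quatForm H := by
  have hf := (contDiffAt_convolution_comp_neg hΩ hu hφ).of_le
    (show (2 : ℕ∞ω) ≤ ∞ by norm_cast)
  refine ⟨_, isHermitian_quatHessian hf, funext fun ξ => ?_⟩
  rw [quatForm_quatHessian hf, hm.integral_eq ξ φ hφ, integral_mul_lineLaplacian_eq hΩ hu hφ]

theorem isHermitian_polarize_real (hm : IsLaplacianFamily Ω u m) (hΩ : IsOpen Ω)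
    (hu : LocallyIntegrableOn u Ω) {A : Set (QSpace n)} (hA : RelCompactBorel Ω A) :
    (polarize fun ξ => (m ξ).real A).IsHermitian := by
  refine sub_eq_zero.1 (hm.map_real_eq_zero hΩ
    (AddMonoidHom.mk' (fun g => (polarize g).conjTranspose - polarize g) fun g h => ?_) ?_
    (fun φ hφ => ?_) hA)
  · rw [map_add, Matrix.conjTranspose_add]
    abel
  · exact polarize.continuous.matrix_conjTranspose.sub polarize.continuous
  · obtain ⟨H, hH, heq⟩ := hm.integral_eq_quatForm hΩ hu hφ
    rw [heq, AddMonoidHom.mk'_apply, polarize_quatForm hH, hH.eq, sub_self]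

theorem quatForm_polarize_real (hm : IsLaplacianFamily Ω u m) (hΩ : IsOpen Ω)
    (hu : LocallyIntegrableOn u Ω) {A : Set (QSpace n)} (hA : RelCompactBorel Ω A)
    (ξ : Fin n → ℍ) : quatForm (polarize fun ξ => (m ξ).real A) ξ = (m ξ).real A := by
  refine congrFun (sub_eq_zero.1 (hm.map_real_eq_zero hΩ
    (AddMonoidHom.mk' (fun g => quatForm (polarize g) - g) fun g h => ?_) ?_
    (fun φ hφ => ?_) hA)) ξ
  · funext ξ
    simp only [map_add, Pi.sub_apply, Pi.add_apply, quatForm_add_matrix]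
    ring
  · exact (continuous_quatForm.comp polarize.continuous).sub continuous_id
  · obtain ⟨H, hH, heq⟩ := hm.integral_eq_quatForm hΩ hu hφ
    rw [heq, AddMonoidHom.mk'_apply, polarize_quatForm hH, sub_self]

open scoped Classical in
/-- The hyperhermitian measure with quadratic form `ξ ↦ m ξ`. -/
def hessianMeasure (hm : IsLaplacianFamily Ω u m) (hΩ : IsOpen Ω)
    (hu : LocallyIntegrableOn u Ω) : HyperhermitianMeasure Ω where
  val A := if RelCompactBorel Ω A then polarize fun ξ => (m ξ).real A else 0
  isHermitian A := by
    split_ifs with hA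
    · exact hm.isHermitian_polarize_real hΩ hu hA
    · exact Matrix.isHermitian_zero
  eq_zero A hA := if_neg hA
  hasSum A hA hd hU := by
    rw [if_pos hU]
    simp only [if_pos (hU.mono (hA _) (subset_iUnion A _))]
    exact polarize.hasSum (hm.hasSum_real hA hd hU)

theorem hessianMeasure_val (hm : IsLaplacianFamily Ω u m) (hΩ : IsOpen Ω)
    (hu : LocallyIntegrableOn u Ω) {A : Set (QSpace n)} (hA : RelCompactBorel Ω A) :
    (hm.hessianMeasure hΩ hu).val A = polarize fun ξ => (m ξ).real A := if_pos hA

theorem nonneg_hessianMeasure (hm : IsLaplacianFamily Ω u m) (hΩ : IsOpen Ω)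
    (hu : LocallyIntegrableOn u Ω) : (hm.hessianMeasure hΩ hu).Nonneg := by
  intro A
  rw [quatNonneg_iff]
  refine ⟨(hm.hessianMeasure hΩ hu).isHermitian A, fun ξ => ?_⟩
  by_cases hA : RelCompactBorel Ω A
  · rw [hm.hessianMeasure_val hΩ hu hA, hm.quatForm_polarize_real hΩ hu hA]
    exact measureReal_nonneg
  · rw [(hm.hessianMeasure hΩ hu).eq_zero A hA]
    simp [quatForm]

theorem integral_hessianMeasure (hm : IsLaplacianFamily Ω u m) (hΩ : IsOpen Ω)
    (hu : LocallyIntegrableOn u Ω) (hφ : Continuous φ) (hφc : HasCompactSupport φ)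
    (hφΩ : tsupport φ ⊆ Ω) (i j : Fin n) :
    (hm.hessianMeasure hΩ hu).integral φ hφc hφΩ i j =
      polarize (fun ξ => ∫ x, φ x ∂(m ξ)) i j := by
  set K := tsupport φ with hKdef
  have hK : IsCompact K := hφc.isCompact
  have hKm : MeasurableSet K := hK.isClosed.measurableSet
  have hfin : ∀ ξ, IsFiniteMeasure ((m ξ).restrict K) := fun ξ =>
    isFiniteMeasure_restrict.2 (hm.lt_top ξ K hK hφΩ).ne
  obtain ⟨C, hC⟩ := hφc.exists_bound_of_continuous hφ
  have hint : ∀ s : SignedMeasure (QSpace n), s.Integrable φ := fun s =>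
    Integrable.of_bound hφ.aestronglyMeasurable C (.of_forall hC)
  have hsm : ∀ ξ, ∫ᵛ z, φ z ∂•((m ξ).restrict K).toSignedMeasure = ∫ z, φ z ∂(m ξ) := by
    intro ξ
    have h1 : (lsmul ℝ ℝ : ℝ →L[ℝ] ℝ →L[ℝ] ℝ) = (lsmul ℝ ℝ).flip := by
      ext
      simp
    rw [h1, VectorMeasure.integral_toSignedMeasure]
    exact setIntegral_eq_integral_of_forall_compl_eq_zero fun z hz =>
      image_eq_zero_of_notMem_tsupport hz
  rw [← sum_inner_quatUnit_smul ((hm.hessianMeasure hΩ hu).integral φ hφc hφΩ i j), polarize_apply]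
  congr 1 with c : 1
  congr 1
  rw [HyperhermitianMeasure.inner_integral_eq _ hφc hφΩ hK hφΩ subset_rfl]
  have hentry : (hm.hessianMeasure hΩ hu).entryMeasure K hK hφΩ i j c = (1 / 2 : ℝ) •
      (((m (Pi.single i (quatUnit c) + Pi.single j 1)).restrict K).toSignedMeasure -
        ((m (Pi.single i (quatUnit c))).restrict K).toSignedMeasure -
        ((m (Pi.single j 1)).restrict K).toSignedMeasure) := by
    ext A hA
    have hAK : RelCompactBorel Ω (A ∩ K) :=
      (RelCompactBorel.of_isCompact hK hφΩ).mono (hA.inter hKm) inter_subset_right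
    rw [HyperhermitianMeasure.entryMeasure_apply _ _ _ _ _ _ hA, hm.hessianMeasure_val hΩ hu hAK,
      polarize_apply, inner_quatUnit_sum_smul]
    simp [Measure.toSignedMeasure_apply_measurable hA, measureReal_restrict_apply hA]
  rw [hentry, VectorMeasure.integral_smul_vectorMeasure,
    VectorMeasure.integral_sub_vectorMeasure (hint _) (hint _),
    VectorMeasure.integral_sub_vectorMeasure (hint _) (hint _), hsm, hsm, hsm, smul_eq_mul]

end IsLaplacianFamily

theorem ContDiffAt.continuousAt_lineLaplacian {f : QSpace n → ℝ} {z : QSpace n}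
    (hf : ContDiffAt ℝ 2 f z) (ξ : Fin n → ℍ) : ContinuousAt (lineLaplacian ξ f) z := by
  have h : ContinuousAt (fderiv ℝ (fderiv ℝ f)) z :=
    ((hf.fderiv_right (m := 1) (by norm_num)).fderiv_right (m := 0) (by norm_num)).continuousAt
  unfold lineLaplacian
  fun_prop

theorem integral_smul_quatHessian {ν : Measure (QSpace n)} {f φ : QSpace n → ℝ}
    (hf : ∀ᵐ z ∂ν, φ z ≠ 0 → ContDiffAt ℝ 2 f z)
    (hint : ∀ ξ, Integrable (fun z => φ z * lineLaplacian ξ f z) ν) (i j : Fin n) :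
    ∫ z, φ z • quatHessian f z i j ∂ν =
      polarize (fun ξ => ∫ z, φ z * lineLaplacian ξ f z ∂ν) i j := by
  have h1 : ∀ᵐ z ∂ν, φ z • quatHessian f z i j =
      polarize (fun ξ => φ z * lineLaplacian ξ f z) i j := by
    filter_upwards [hf] with z hz
    have h2 : (fun ξ => φ z * lineLaplacian ξ f z) = φ z • fun ξ => lineLaplacian ξ f z := rfl
    rw [h2, map_smul, Matrix.smul_apply]
    by_cases h0 : φ z = 0
    · simp [h0]
    · rw [polarize_lineLaplacian (hz h0)]
  rw [integral_congr_ae h1]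
  simp only [polarize_apply]
  have hsub : ∀ ξ η, Integrable
      (fun z => φ z * lineLaplacian ξ f z - φ z * lineLaplacian η f z) ν :=
    fun ξ η => (hint ξ).sub (hint η)
  have hsub' : ∀ ξ η ζ, Integrable (fun z => φ z * lineLaplacian ξ f z -
      φ z * lineLaplacian η f z - φ z * lineLaplacian ζ f z) ν :=
    fun ξ η ζ => (hsub ξ η).sub (hint ζ)
  rw [integral_finsetSum _ fun c _ => ((hsub' _ _ _).const_mul _).smul_const _]
  congr 1 with c : 1
  rw [integral_smul_const, integral_const_mul, integral_sub (hsub _ _) (hint _),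
    integral_sub (hint _) (hint _)]

theorem integrable_mul_lineLaplacian_of_contDiffAt {f : QSpace n → ℝ} (hφ : Continuous φ)
    (hφc : HasCompactSupport φ) (hf : ∀ z ∈ tsupport φ, ContDiffAt ℝ 2 f z) (ξ : Fin n → ℍ) :
    Integrable fun z => φ z * lineLaplacian ξ f z := by
  have h1 : IntegrableOn (fun z => φ z * lineLaplacian ξ f z) (tsupport φ) :=
    ContinuousOn.integrableOn_compact hφc.isCompact fun z hz =>
      (hφ.continuousAt.mul ((hf z hz).continuousAt_lineLaplacian ξ)).continuousWithinAt
  rwa [integrableOn_iff_integrable_of_support_subset] at h1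
  intro x hx
  by_contra hxK
  exact hx (by simp [image_eq_zero_of_notMem_tsupport hxK])

namespace IsLaplacianFamily

theorem hessianWeakLimit_hessianMeasure (hm : IsLaplacianFamily Ω u m) (hΩ : IsOpen Ω)
    (hu : LocallyIntegrableOn u Ω) (hχ : SmoothingKernel χ) :
    HessianWeakLimit χ u (hm.hessianMeasure hΩ hu) := by
  intro φ hφ hφc hφΩ i j
  rw [hm.integral_hessianMeasure hΩ hu hφ]
  obtain ⟨K, hK, hKΩ, -, hev⟩ :=
    exists_isCompact_eventually_sub_smul_mem hΩ hχ.compactSupport hφc hφΩ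
  have h1 : Tendsto (fun (ε : ℝ) ξ => ∫ z, φ z * lineLaplacian ξ (mollify χ u ε) z) (𝓝[>] 0)
      (𝓝 fun ξ => ∫ z, φ z ∂(m ξ)) :=
    tendsto_pi_nhds.2 fun ξ => hm.tendsto_integral_mollify hΩ hu hχ hφ hφc hφΩ ξ
  have h2 := ((continuous_id.matrix_elem i j).comp polarize.continuous).tendsto
    (fun ξ => ∫ z, φ z ∂(m ξ))
  refine (h2.comp h1).congr' ?_
  filter_upwards [nhdsWithin_le_nhds hev, self_mem_nhdsWithin] with ε hεK hε
  have hsmooth : ∀ z ∈ tsupport φ, ContDiffAt ℝ 2 (mollify χ u ε) z := fun z hz =>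
    (contDiffAt_mollify hΩ hu hχ hε fun w hw => hKΩ (hεK z hz w hw)).of_le (by norm_cast)
  exact (integral_smul_quatHessian
    (.of_forall fun z hz => hsmooth z (subset_tsupport _ hz))
    (integrable_mul_lineLaplacian_of_contDiffAt hφ hφc hsmooth) i j).symm

/-- For a `C²` function the measures `m ξ` have the pointwise Laplacians as densities. -/
theorem real_eq_setIntegral (hm : IsLaplacianFamily Ω u m) (hΩ : IsOpen Ω)
    (hu : ContDiffOn ℝ 2 u Ω) {A : Set (QSpace n)} (hA : RelCompactBorel Ω A) (ξ : Fin n → ℍ) :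
    IntegrableOn (lineLaplacian ξ u) A ∧ (m ξ).real A = ∫ z in A, lineLaplacian ξ u z := by
  have hint : ∀ {B}, RelCompactBorel Ω B → IntegrableOn (lineLaplacian ξ u) B := by
    rintro B ⟨-, K, hK, hKΩ, hBK⟩
    refine (ContinuousOn.integrableOn_compact hK fun z hz => ?_).mono_set hBK
    exact ((hu.contDiffAt
      (hΩ.mem_nhds (hKΩ hz))).continuousAt_lineLaplacian ξ).continuousWithinAt
  refine ⟨hint hA, sub_eq_zero.1 (hA.eq_zero_of_forall_isCompact (Ω := Ω)
    (fun A => (m ξ).real A - ∫ z in A, lineLaplacian ξ u z)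
    (fun B hB hd hU => ((Pi.hasSum.1 (hm.hasSum_real hB hd hU)) ξ).sub
      (hasSum_integral_iUnion hB hd (hint hU))) fun K hK hKΩ => ?_)⟩
  obtain ⟨L, φ, hL, hLΩ, -, hφ, hφL, h01, hlim⟩ :=
    exists_seq_isTestFunction_tendsto_indicator hΩ hK hKΩ
  have h1 := hm.tendsto_integral_indicator hK hL hLΩ hφ hφL h01 hlim ξ
  have h2 : Tendsto (fun k => ∫ x, φ k x * lineLaplacian ξ u x) atTop
      (𝓝 (∫ z in K, lineLaplacian ξ u z)) := by
    have h3 : ∫ z in K, lineLaplacian ξ u z = ∫ z, K.indicator 1 z * lineLaplacian ξ u z := by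
      rw [← integral_indicator hK.isClosed.measurableSet]
      congr 1 with z
      by_cases hz : z ∈ K <;> simp [hz]
    rw [h3]
    have hLi : Integrable (L.indicator fun z => ‖lineLaplacian ξ u z‖) :=
      (integrable_indicator_iff hL.isClosed.measurableSet).2
        (hint (.of_isCompact hL hLΩ)).norm
    refine tendsto_integral_of_dominated_convergence _ (fun k => ?_) hLi
      (fun k => .of_forall fun x => ?_) (.of_forall fun x => (hlim x).mul_const _)
    · exact (integrable_mul_lineLaplacian_of_contDiffAt (hφ k).contDiff.continuous
        (hφ k).hasCompactSupport (fun z hz => hu.contDiffAt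
          (hΩ.mem_nhds ((hφ k).tsupport_subset hz))) ξ).aestronglyMeasurable
    · by_cases hx : x ∈ L
      · rw [indicator_of_mem hx, norm_mul, Real.norm_eq_abs, abs_of_nonneg (h01 k x).1]
        exact mul_le_of_le_one_left (norm_nonneg _) (h01 k x).2
      · rw [image_eq_zero_of_notMem_tsupport fun h => hx (hφL k h), indicator_of_notMem hx]
        simp
  rw [sub_eq_zero]
  refine tendsto_nhds_unique h1 (h2.congr fun k => ?_)
  rw [hm.integral_eq ξ _ (hφ k), integral_mul_lineLaplacian_comm hΩ hu (hφ k)]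

theorem hessianMeasure_val_eq_setIntegral (hm : IsLaplacianFamily Ω u m) (hΩ : IsOpen Ω)
    (hu : LocallyIntegrableOn u Ω) (hu2 : ContDiffOn ℝ 2 u Ω) {A : Set (QSpace n)}
    (hA : RelCompactBorel Ω A) (i j : Fin n) :
    (hm.hessianMeasure hΩ hu).val A i j = ∫ z in A, quatHessian u z i j := by
  have h := integral_smul_quatHessian (ν := volume.restrict A) (f := u) (φ := fun _ => 1)
    ((ae_restrict_iff' hA.1).2 (.of_forall fun z hz _ => by
      obtain ⟨-, K, -, hKΩ, hAK⟩ := hA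
      exact hu2.contDiffAt (hΩ.mem_nhds (hKΩ (hAK hz)))))
    (fun ξ => by simp only [one_mul]; exact (hm.real_eq_setIntegral hΩ hu2 hA ξ).1) i j
  simp only [one_smul, one_mul] at h
  rw [h, hm.hessianMeasure_val hΩ hu hA]
  simp_rw [fun ξ => (hm.real_eq_setIntegral hΩ hu2 hA ξ).2]

end IsLaplacianFamily

end Construction

end

theorem mainTheorem12 {n : ℕ} (Ω : Set (QSpace n)) (hΩ : IsOpen Ω) (u : QSpace n → ℝ)
    (hu : QuatPsh Ω u) :
    LocallyIntegrableOn u Ω volume ∧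
    (∀ χ : QSpace n → ℝ, SmoothingKernel χ → ∀ ε : ℝ, 0 < ε →
      ContDiffOn ℝ ∞ (mollify χ u ε) (mollifyDomain χ Ω ε)) ∧
    ∃ μ : HyperhermitianMeasure Ω,
      (∀ χ : QSpace n → ℝ, SmoothingKernel χ → HessianWeakLimit χ u μ) ∧
      (∀ (ν : HyperhermitianMeasure Ω) (χ : QSpace n → ℝ), SmoothingKernel χ →
        HessianWeakLimit χ u ν → ν = μ) ∧
      μ.Nonneg ∧
      (ContDiffOn ℝ 2 u Ω → ∀ A, RelCompactBorel Ω A → ∀ i j : Fin n,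
        μ.val A i j = ∫ z in A, quatHessian u z i j) := by
  have hli := hu.locallyIntegrableOn hΩ
  obtain ⟨m, hm⟩ := hu.exists_isLaplacianFamily hΩ
  refine ⟨hli, fun χ hχ ε hε z hz => (contDiffAt_mollify hΩ hli hχ hε hz).contDiffWithinAt,
    hm.hessianMeasure hΩ hli, fun χ hχ => hm.hessianWeakLimit_hessianMeasure hΩ hli hχ,
    fun ν χ hχ hν => ?_, hm.nonneg_hessianMeasure hΩ hli,
    fun hu2 A hA i j => hm.hessianMeasure_val_eq_setIntegral hΩ hli hu2 hA i j⟩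
  refine HyperhermitianMeasure.ext_of_integral_eq hΩ fun φ hφ hφc hφΩ i j => ?_
  exact tendsto_nhds_unique (hν φ hφ.contDiff.continuous hφc hφΩ i j)
    (hm.hessianWeakLimit_hessianMeasure hΩ hli hχ φ hφ.contDiff.continuous hφc hφΩ i j)
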